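/- Let $\mathcal{Z}(2)=S^2(\mathbb{R}^2)\otimes\mathbb{R}^2$ be the space of constant Christoffel symbols $\Gamma=(\Gamma_{ij}{}^k)$ on $\mathbb{R}^2$ with $\Gamma_{ij}{}^k=\Gamma_{ji}{}^k$; each defines a torsion-free connection $\nabla^\Gamma$ on $\mathbb{R}^2$ by $\nabla_{\partial_i}\partial_j=\Gamma_{ij}{}^k\partial_k$, with (symmetric) Ricci tensor $\rho_{\Gamma,jk}=\Gamma_{in}{}^i\Gamma_{jk}{}^n-\Gamma_{jn}{}^i\Gamma_{ik}{}^n$. For $p+q=2$ let $\mathcal{Z}(p,q)\subset\mathcal{Z}(2)$ be the set of $\Gamma$ for which $\rho_\Gamma$ is non-degenerate with $p$ negative and $q$ positive directions. Write $\Gamma\sim\tilde\Gamma$ if there is a germ of an orientation preserving diffeomorphism $\Phi$ of $\mathbb{R}^2$, from some point to some point, with $\Phi^*\nabla^{\tilde\Gamma}=\nabla^\Gamma$, and let $\mathfrak{Z}^+(p,q)=\mathcal{Z}(p,q)/\!\sim$ with the quotient topology. The group $\mathrm{GL}^+(2,\mathbb{R})$ of matrices of positive determinant acts (from the right) by change of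 coordinates, $(T\Gamma)(e_i,e_j,e^k)=\Gamma(Te_i,Te_j,Te^k)$ with $Te^k=e^k\circ T^{-1}$; put $G_\Gamma^+=\{T\in\mathrm{GL}^+(2,\mathbb{R}):T\Gamma=\Gamma\}$. The action on an invariant set $N$ is fixed point free if $G_\Gamma^+=\{\mathrm{id}\}$ for all $\Gamma\in N$, and proper if, whenever $\Gamma_n\to\Gamma$ and $g_n\Gamma_n\to\tilde\Gamma$ with all of these points in $N$, a subsequence of $(g_n)$ converges in $\mathrm{GL}^+(2,\mathbb{R})$. Let $\Gamma_2$ be the structure with $\Gamma_{11}{}^1=\frac1{\sqrt2}$, $\Gamma_{12}{}^2=\Gamma_{21}{}^2=\Gamma_{22}{}^1=-\frac1{\sqrt2}$ and all other symbols $0$; it lies in $\mathcal{Z}(2,0)$. **Theorem 1.11.** 1. Let $(p,q)=(1,1)$ or $(p,q)=(0,2)$. The action of $\mathrm{GL}^+(2,\mathbb{R})$ on $\mathcal{Z}(p,q)$ is fixed point free and proper, and $\mathfrak{Z}^+(p,q)$ carries the structure of a real-analytic surface (Hausdorff, second countable, compatible with the quotient topology) for which the projection $\mathcal{Z}(p,q)\to\mathfrak{Z}^+(p,q)$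 is a real-analytic principal $\mathrm{GL}^+(2,\mathbb{R})$-bundle. 2. Let $(p,q)=(2,0)$. If $\Gamma\in\mathcal{Z}(2,0)$ and $G_\Gamma^+\neq\{\mathrm{id}\}$, then $G_\Gamma^+\cong\mathbb{Z}_3$ and $\Gamma\sim\Gamma_2$; moreover the set of $\Gamma\in\mathcal{Z}(2,0)$ with $G_\Gamma^+\ne\{\mathrm{id}\}$ is exactly the orbit $\mathrm{GL}^+(2,\mathbb{R})\,\Gamma_2$. The action of $\mathrm{GL}^+(2,\mathbb{R})$ on $\mathcal{Z}(2,0)$ is proper. The projection maps $\mathcal{Z}(2,0)\setminus\mathrm{GL}^+(2,\mathbb{R})\,\Gamma_2$ to $\mathfrak{Z}^+(2,0)\setminus\{[\Gamma_2]\}$, and the latter carries the structure of a real-analytic surface (Hausdorff, second countable, compatible with the subspace topology) for which this map is a real-analytic principal $\mathrm{GL}^+(2,\mathbb{R})$-bundle. -/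

import Mathlib

open scoped ContDiff Manifold MatrixGroups Topology

noncomputable section

namespace TypeA

/-! ### Parameter space, connections and the Ricci tensor -/

/-- The space `𝒵(2) = S²(ℝ²) ⊗ ℝ²` of torsion-free constant Christoffel symbols on the plane;
`Γ i j k` is the symbol with lower indices `i`, `j` and upper index `k`. -/
def Z2 : Submodule ℝ (Fin 2 → Fin 2 → Fin 2 → ℝ) where
  carrier := {Γ | ∀ i j k, Γ i j k = Γ j i k}
  add_mem' := fun ha hb i j k => by simp [ha i j k, hb i j k]
  zero_mem' := fun _ _ _ => rfl
  smul_mem' := fun c Γ h i j k => by simp [h i j k]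

/-- The covariant derivative `∇_ξ η` of vector fields on (a part of) the plane, for the connection
with constant Christoffel symbols `Γ`, i.e. `∇_{∂_i} ∂_j = ∑ k, Γ i j k ∂_k`. -/
def nabla (Γ : Z2) (ξ η : (Fin 2 → ℝ) → (Fin 2 → ℝ)) (x : Fin 2 → ℝ) : Fin 2 → ℝ :=
  fun k => fderiv ℝ η x (ξ x) k + ∑ i, ∑ j, Γ.1 i j k * ξ x i * η x j

/-- The components `R_{ijk}^l` of the curvature operator; the derivative terms vanish since the
Christoffel symbols are constant. -/
def curvature (Γ : Z2) (i j k l : Fin 2) : ℝ :=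
  ∑ n, (Γ.1 i n l * Γ.1 j k n - Γ.1 j n l * Γ.1 i k n)

/-- The Ricci tensor `ρ(ξ, η) = Tr {σ ↦ R(σ, ξ) η}`. -/
def ricci (Γ : Z2) (j k : Fin 2) : ℝ := ∑ i, curvature Γ i j k i

/-- The symmetric Ricci tensor. -/
def symRicci (Γ : Z2) : Matrix (Fin 2) (Fin 2) ℝ :=
  Matrix.of fun j k => (ricci Γ j k + ricci Γ k j) / 2

/-- `𝒵(p, q)`: the symmetric Ricci tensor is non-degenerate (`p + q = 2`) with `p` timelike
(negative) and `q` spacelike (positive) directions. -/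
def Z (p q : ℕ) : Set Z2 :=
  {Γ | p + q = 2 ∧ sigNeg (symRicci Γ).toQuadraticForm' = p ∧
    sigPos (symRicci Γ).toQuadraticForm' = q}

/-! ### Local isomorphism and moduli spaces -/

/-- The push-forward `Φ_* ξ` of a vector field under a partial diffeomorphism. -/
def pushforward (Φ : OpenPartialHomeomorph (Fin 2 → ℝ) (Fin 2 → ℝ))
    (ξ : (Fin 2 → ℝ) → (Fin 2 → ℝ)) (y : Fin 2 → ℝ) : Fin 2 → ℝ :=
  fderiv ℝ Φ (Φ.symm y) (ξ (Φ.symm y))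

/-- `Γ ∼ Γ'`: there is a germ (at some point `P`, represented by a map `Φ` between open sets) of an
orientation preserving diffeomorphism with `Φ^* ∇^{Γ'} = ∇^Γ`. -/
def LocallyIsomorphic (Γ Γ' : Z2) : Prop :=
  ∃ (Φ : OpenPartialHomeomorph (Fin 2 → ℝ) (Fin 2 → ℝ)) (P : Fin 2 → ℝ), P ∈ Φ.source ∧
    ContDiffOn ℝ ∞ Φ Φ.source ∧ ContDiffOn ℝ ∞ Φ.symm Φ.target ∧
    (∀ x ∈ Φ.source, 0 < (fderiv ℝ Φ x).det) ∧
    ∀ ξ η : (Fin 2 → ℝ) → (Fin 2 → ℝ), ContDiffOn ℝ ∞ ξ Φ.source → ContDiffOn ℝ ∞ η Φ.source →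
      ∀ x ∈ Φ.source, nabla Γ' (pushforward Φ ξ) (pushforward Φ η) (Φ x) =
        fderiv ℝ Φ x (nabla Γ ξ η x)

/-- The moduli space `ℨ⁺(p, q) = 𝒵(p, q) / ∼`, with the quotient topology. -/
abbrev Moduli (p q : ℕ) : Type :=
  Quot fun Γ Γ' : Z p q => LocallyIsomorphic Γ.1 Γ'.1

/-- The class `[Γ]` in the moduli space. -/
abbrev Moduli.mk {p q : ℕ} (Γ : Z p q) : Moduli p q := Quot.mk _ Γ

/-! ### The action of the general linear group -/

/-- Change of coordinates, `(TΓ)(e_i, e_j, e^k) = Γ(T e_i, T e_j, T e^k)`, where `T` acts on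
covectors by `T e^k = e^k ∘ T⁻¹`. This is a right action: `(ST)Γ = T(SΓ)`. -/
def act (T : GL(2, ℝ)⁺) (Γ : Z2) : Z2 :=
  ⟨fun i j k => ∑ a, ∑ b, ∑ c, T.1.1 a i * T.1.1 b j * (T⁻¹).1.1 k c * Γ.1 a b c, by
    intro i j k
    simp only
    rw [Finset.sum_comm]
    refine Finset.sum_congr rfl fun b _ => Finset.sum_congr rfl fun a _ =>
      Finset.sum_congr rfl fun c _ => ?_
    rw [Γ.2 a b c]
    ring⟩

theorem act_one (Γ : Z2) : act 1 Γ = Γ := by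
  ext i j k
  simp [act, Matrix.one_apply]

theorem act_mul (S T : GL(2, ℝ)⁺) (Γ : Z2) : act (S * T) Γ = act T (act S Γ) := by
  ext i j k
  simp only [act, mul_inv_rev, Subgroup.coe_mul, Units.val_mul, Matrix.mul_apply,
    Fin.sum_univ_two]
  ring

/-- The group `G_Γ⁺` of orientation preserving linear symmetries of `Γ`. -/
def isotropy (Γ : Z2) : Subgroup (GL(2, ℝ)⁺) where
  carrier := {T | act T Γ = Γ}
  mul_mem' := fun {S T} hS hT => by
    simp only [Set.mem_ofPred_eq] at *
    rw [act_mul, hS, hT]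
  one_mem' := act_one Γ
  inv_mem' := fun {T} hT => by
    simp only [Set.mem_ofPred_eq] at *
    conv_lhs => rw [← hT]
    rw [← act_mul, mul_inv_cancel, act_one]

/-- The orbit of `Γ` under the general linear group. -/
def orbit (Γ : Z2) : Set Z2 := Set.range fun T => act T Γ

/-- The action on `N ⊆ 𝒵(2)` is fixed point free. -/
def FixedPointFree (N : Set Z2) : Prop := ∀ Γ ∈ N, isotropy Γ = ⊥

/-- The action on `N ⊆ 𝒵(2)` is proper: if `Γ_n → Γ` and `g_n Γ_n → Γ'` within `N`,
then a subsequence of `g_n` converges in the group. -/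
def ProperAction (N : Set Z2) : Prop :=
  ∀ (Γ : ℕ → Z2) (g : ℕ → GL(2, ℝ)⁺), (∀ n, Γ n ∈ N) → (∀ n, act (g n) (Γ n) ∈ N) →
    ∀ Γ₁ ∈ N, ∀ Γ₂ ∈ N, Filter.Tendsto Γ Filter.atTop (𝓝 Γ₁) →
      Filter.Tendsto (fun n => act (g n) (Γ n)) Filter.atTop (𝓝 Γ₂) →
      ∃ (φ : ℕ → ℕ) (h : GL(2, ℝ)⁺), StrictMono φ ∧
        Filter.Tendsto (fun n => g (φ n)) Filter.atTop (𝓝 h)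

/-! ### Real-analytic principal bundles -/

/-- The inclusion of the group into the space of all `2 × 2` arrays. -/
def entries (T : GL(2, ℝ)⁺) : Fin 2 → Fin 2 → ℝ := fun i j => T.1.1 i j

theorem isOpenEmbedding_entries : Topology.IsOpenEmbedding entries := by
  have h1 : Topology.IsEmbedding (Units.val : GL (Fin 2) ℝ → Matrix (Fin 2) (Fin 2) ℝ) := by
    refine Units.isEmbedding_val_mk' (f := fun A : Matrix (Fin 2) (Fin 2) ℝ => A⁻¹) ?_
      fun u => (Matrix.coe_units_inv u).symm
    have hd : ContinuousOn (fun A : Matrix (Fin 2) (Fin 2) ℝ => A.det⁻¹ • A.adjugate)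
        {A | IsUnit A} := by
      have hdet : Continuous fun A : Matrix (Fin 2) (Fin 2) ℝ => A.det :=
        continuous_id.matrix_det
      have hadj : Continuous fun A : Matrix (Fin 2) (Fin 2) ℝ => A.adjugate :=
        continuous_id.matrix_adjugate
      exact (hdet.continuousOn.inv₀ fun A hA =>
        ((Matrix.isUnit_iff_isUnit_det A).1 hA).ne_zero).smul hadj.continuousOn
    refine hd.congr fun A _ => ?_
    simp only [Matrix.inv_def, Ring.inverse_eq_inv']
  have h2 : Topology.IsEmbedding (Subtype.val : GL(2, ℝ)⁺ → GL (Fin 2) ℝ) :=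
    Topology.IsEmbedding.subtypeVal
  refine ⟨h1.comp h2, ?_⟩
  have hr : Set.range entries = {A : Matrix (Fin 2) (Fin 2) ℝ | 0 < A.det} := by
    ext A
    constructor
    · rintro ⟨T, rfl⟩
      exact T.2
    · intro hA
      exact ⟨⟨Matrix.GeneralLinearGroup.mkOfDetNeZero A (ne_of_gt hA), hA⟩, rfl⟩
  rw [hr]
  exact isOpen_lt continuous_const (continuous_id.matrix_det)

/-- `GL⁺(2, ℝ)` is a real-analytic manifold, as an open subset of the space of `2 × 2` arrays. -/
instance : ChartedSpace (Fin 2 → Fin 2 → ℝ) (GL(2, ℝ)⁺) :=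
  isOpenEmbedding_entries.singletonChartedSpace

/-- `B` is a real-analytic surface: a Hausdorff second countable two-dimensional manifold with
real-analytic transition maps. -/
structure IsAnalyticSurface (B : Type) [TopologicalSpace B]
    [ChartedSpace (EuclideanSpace ℝ (Fin 2)) B] : Prop where
  t2 : T2Space B
  secondCountable : SecondCountableTopology B
  analytic : IsManifold (𝓡 2) ω B

/-- `π : N → B` is a real-analytic principal `GL⁺(2, ℝ)`-bundle over the surface `B`, where `N` is a
subset of `𝒵(2)` with the (right) action `act`. Around every point of the base there is a
neighbourhood `U` and an equivariant real-analytic diffeomorphism `e` of `U × GL⁺(2, ℝ)`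
onto `π⁻¹(U)` over `U`. In particular `N` is open in `𝒵(2)`, and the fibres of `π` are orbits. -/
def IsAnalyticPrincipalBundle {B : Type} [TopologicalSpace B]
    [ChartedSpace (EuclideanSpace ℝ (Fin 2)) B] (N : Set Z2) (π : N → B) : Prop :=
  ∀ b : B, ∃ (U : Set B) (e : OpenPartialHomeomorph (B × GL(2, ℝ)⁺) Z2),
    IsOpen U ∧ b ∈ U ∧
    e.source = U ×ˢ Set.univ ∧
    e.target = Subtype.val '' (π ⁻¹' U) ∧
    (∀ u ∈ U, ∀ g, ∃ h : e (u, g) ∈ N, π ⟨e (u, g), h⟩ = u) ∧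
    (∀ u ∈ U, ∀ g h, e (u, g * h) = act h (e (u, g))) ∧
    ContMDiffOn ((𝓡 2).prod 𝓘(ℝ, Fin 2 → Fin 2 → ℝ)) 𝓘(ℝ, Z2) ω e e.source ∧
    ContMDiffOn 𝓘(ℝ, Z2) ((𝓡 2).prod 𝓘(ℝ, Fin 2 → Fin 2 → ℝ)) ω e.symm e.target

/-! ### The exceptional structure -/

/-- The structure `Γ₂`: `Γ_{11}^1 = 1/√2`, `Γ_{12}^2 = Γ_{21}^2 = -1/√2`, `Γ_{22}^1 = -1/√2`, and
all other symbols vanish. -/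
def Gamma2 : Z2 :=
  ⟨![![![1 / √2, 0], ![0, -(1 / √2)]], ![![0, -(1 / √2)], ![-(1 / √2), 0]]], by
    intro i j k
    fin_cases i <;> fin_cases j <;> rfl⟩

theorem symRicci_Gamma2 : symRicci Gamma2 = Matrix.diagonal fun _ => -1 := by
  have h : (√2)⁻¹ * (√2)⁻¹ = (1 / 2 : ℝ) := by
    rw [← mul_inv, Real.mul_self_sqrt (by norm_num)]
    norm_num
  ext i j
  fin_cases i <;> fin_cases j <;>
    simp [symRicci, ricci, curvature, Gamma2, Fin.sum_univ_two] <;> linarith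

theorem Gamma2_mem : Gamma2 ∈ Z 2 0 := by
  have hq : (symRicci Gamma2).toQuadraticForm' =
      QuadraticMap.weightedSumSquares ℝ (fun _ : Fin 2 => (-1 : ℝ)) := by
    ext x
    rw [symRicci_Gamma2]
    simp [Matrix.toQuadraticForm', QuadraticMap.weightedSumSquares_apply, Matrix.toLinearMap₂'_apply',
      LinearMap.BilinMap.toQuadraticMap_apply, Matrix.mulVec_diagonal, dotProduct]
  refine ⟨rfl, ?_, ?_⟩ <;> rw [hq]
  · rw [QuadraticForm.sigNeg_weightedSumSquares]
    simp [Set.ncard_univ]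
  · rw [QuadraticForm.sigPos_weightedSumSquares]
    norm_num

/-- The point `[Γ₂]` of the moduli space. -/
abbrev exceptionalPoint : Moduli 2 0 := Moduli.mk ⟨Gamma2, Gamma2_mem⟩

end TypeA

end

noncomputable section

namespace TypeA

/-! Two reductions turn the statement into linear algebra. The first is that local isomorphism is
the same as lying in one `GL⁺(2, ℝ)`-orbit. If Φ is affine between ∇^Γ and ∇^Γ', its Jacobian F
satisfies ∂F = FΓ − Γ'(F, F); integrability gives F^*ρ' = ρ, and both tensors have constant
components. Differentiating this relation and using that ∂F is symmetric in its lower indices forces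
∂F = 0 when ρ' is non-degenerate, by the argument that proves uniqueness of the Levi-Civita
connection. So F is constant and carries Γ' to Γ (`LocallyIsomorphic.exists_act_eq`; the converse is
`locallyIsomorphic_act`).

The second is that a slice suffices. Let s be an analytic map from an open subset of the plane to
𝒵(2) that is transverse to the orbits, meets each orbit at most once and has trivial isotropy along
its image. Since 2 + 4 = 6, the inverse function theorem makes (v, g) ↦ g s(v) an equivariant
analytic chart (`exists_sliceChart`). Slices covering N yield freeness, an atlas of the quotient and
local trivialisations (`exists_analyticSurface_principalBundle`). The quotient is Hausdorff because
the action is proper.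

Definite case. In a frame where ρ is a non-zero multiple of the Euclidean metric, Γ with its index
lowered is a totally symmetric cubic form. If the trace form Σ_i Γ_{ji}^i is non-zero, requiring it
to be 4e¹ fixes the oriented conformal frame, and the remaining two parameters form a single global
slice. If the trace vanishes, the cubic is harmonic, the real part of a complex multiple of z³; then
ρ is negative, rotations and dilations act transitively on such cubics, and the isotropy is the
group of cube roots of unity. This is the orbit of Γ₂. Properness holds because ρ bounds the entries
of the group elements.

Indefinite case. In a frame with ρ = 2e¹e² the symbols b = Γ₁₁², c = Γ₁₂¹, d = Γ₁₂², e = Γ₂₂¹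
determine Γ and satisfy cd − be = 1. Only diag(t, 1/t) remains of the group; it acts on (b, c, d, e)
with the odd weights 3, −1, 1, −3. Normalising d, c or b to 1 gives slices that cover 𝒵(1,1), and
the weights bound t and 1/t, which gives properness. -/

/-! ### The Ricci tensor in coordinates and its signature -/

theorem ricci_zero_zero (Γ : Z2) : ricci Γ 0 0 =
    Γ.1 0 1 1 * (Γ.1 0 0 0 - Γ.1 0 1 1) + Γ.1 0 0 1 * (Γ.1 1 1 1 - Γ.1 0 1 0) := by
  simp only [ricci, curvature, Fin.sum_univ_two, Γ.2 1 0]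
  ring

theorem ricci_zero_one (Γ : Z2) : ricci Γ 0 1 =
    Γ.1 0 1 0 * Γ.1 0 1 1 - Γ.1 0 0 1 * Γ.1 1 1 0 := by
  simp only [ricci, curvature, Fin.sum_univ_two, Γ.2 1 0]
  ring

theorem ricci_one_one (Γ : Z2) : ricci Γ 1 1 =
    Γ.1 0 1 0 * (Γ.1 1 1 1 - Γ.1 0 1 0) + Γ.1 1 1 0 * (Γ.1 0 0 0 - Γ.1 0 1 1) := by
  simp only [ricci, curvature, Fin.sum_univ_two, Γ.2 1 0]
  ring

theorem ricci_one_zero (Γ : Z2) : ricci Γ 1 0 = ricci Γ 0 1 := by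
  simp only [ricci, curvature, Fin.sum_univ_two, Γ.2 1 0]
  ring

theorem symRicci_apply (Γ : Z2) (j k : Fin 2) : symRicci Γ j k = ricci Γ j k := by
  fin_cases j <;> fin_cases k <;> simp [symRicci, ricci_one_zero]

/-- The determinant of the Ricci tensor. -/
def ricciDet (Γ : Z2) : ℝ := ricci Γ 0 0 * ricci Γ 1 1 - ricci Γ 0 1 ^ 2

theorem symRicci_quadraticForm_apply (Γ : Z2) (x : Fin 2 → ℝ) :
    (symRicci Γ).toQuadraticForm' x =
      ricci Γ 0 0 * x 0 ^ 2 + 2 * ricci Γ 0 1 * (x 0 * x 1) + ricci Γ 1 1 * x 1 ^ 2 := by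
  simp [Matrix.toQuadraticForm', Matrix.toLinearMap₂'_apply', LinearMap.BilinMap.toQuadraticMap_apply,
    dotProduct, Matrix.mulVec, Fin.sum_univ_two, symRicci_apply, ricci_one_zero]
  ring

theorem sigPos_eq_two_iff (Q : QuadraticForm ℝ (Fin 2 → ℝ)) : sigPos Q = 2 ↔ Q.PosDef := by
  constructor
  · intro h
    obtain ⟨V, hV, hp⟩ := exists_finrank_eq_sigPos_and_posDef Q
    have hT : V = ⊤ := Submodule.eq_top_of_finrank_eq (by simp [hV, h])
    subst hT
    intro x hx
    exact hp ⟨x, trivial⟩ fun h => hx (congrArg Subtype.val h)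
  · intro h
    have h1 := sigPos_le_finrank Q
    have h2 : Module.finrank ℝ (⊤ : Submodule ℝ (Fin 2 → ℝ)) ≤ sigPos Q :=
      le_sigPos_of_posDef Q fun x hx => h x fun h0 => hx (Subtype.ext h0)
    simp at h1 h2
    omega

theorem one_le_sigPos_iff (Q : QuadraticForm ℝ (Fin 2 → ℝ)) : 1 ≤ sigPos Q ↔ ∃ x, 0 < Q x := by
  constructor
  · intro h
    obtain ⟨V, hV, hp⟩ := exists_finrank_eq_sigPos_and_posDef Q
    have : Nontrivial V := Module.nontrivial_of_finrank_pos (R := ℝ) (by omega)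
    obtain ⟨x, hx⟩ := exists_ne (0 : V)
    exact ⟨x, hp x hx⟩
  · rintro ⟨x, hx⟩
    have hx0 : x ≠ 0 := by
      rintro rfl
      simp at hx
    have h2 : Module.finrank ℝ (ℝ ∙ x) ≤ sigPos Q := by
      refine le_sigPos_of_posDef Q ?_
      rintro ⟨y, hy⟩ hy0
      obtain ⟨c, rfl⟩ := Submodule.mem_span_singleton.1 hy
      have hc : c ≠ 0 := by
        rintro rfl
        simp at hy0
      simp only [QuadraticMap.restrict_apply, QuadraticMap.map_smul, smul_eq_mul]
      exact mul_pos (mul_self_pos.2 hc) hx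
    rwa [finrank_span_singleton hx0] at h2

theorem sigNeg_le_two_sub (Q : QuadraticForm ℝ (Fin 2 → ℝ)) : sigPos Q + sigNeg Q ≤ 2 := by
  have := QuadraticForm.sigPos_add_sigNeg_add_radical (Q := Q)
  simp at this
  omega

/-- Sylvester's criterion. It replaces signatures by polynomial inequalities, whose openness and
behaviour under the action are visible. -/
theorem mem_Z_zero_two_iff (Γ : Z2) : Γ ∈ Z 0 2 ↔ 0 < ricciDet Γ ∧ 0 < ricci Γ 0 0 := by
  have h0 := sigNeg_le_two_sub (symRicci Γ).toQuadraticForm'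
  have h1 : Γ ∈ Z 0 2 ↔ sigPos (symRicci Γ).toQuadraticForm' = 2 :=
    ⟨fun h => h.2.2, fun h => ⟨rfl, by omega, h⟩⟩
  rw [h1, sigPos_eq_two_iff]
  constructor
  · intro h
    have ha : 0 < ricci Γ 0 0 := by
      have := h ![1, 0] (by simp)
      simpa [symRicci_quadraticForm_apply] using this
    refine ⟨?_, ha⟩
    -- The form takes the value `ricci Γ 0 0 * ricciDet Γ` at this vector.
    have := h ![-ricci Γ 0 1, ricci Γ 0 0] (by simp [ha.ne'])
    simp only [symRicci_quadraticForm_apply, Matrix.cons_val_zero, Matrix.cons_val_one] at this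
    refine pos_of_mul_pos_right (a := ricci Γ 0 0) ?_ ha.le
    rw [ricciDet]
    linarith
  · rintro ⟨hD, ha⟩ x hx
    rw [symRicci_quadraticForm_apply]
    refine pos_of_mul_pos_right (a := ricci Γ 0 0) ?_ ha.le
    have e : ricci Γ 0 0 * (ricci Γ 0 0 * x 0 ^ 2 + 2 * ricci Γ 0 1 * (x 0 * x 1) +
        ricci Γ 1 1 * x 1 ^ 2) = (ricci Γ 0 0 * x 0 + ricci Γ 0 1 * x 1) ^ 2
          + ricciDet Γ * x 1 ^ 2 := by
      rw [ricciDet]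
      ring
    rw [e]
    by_cases h1 : x 1 = 0
    · have h2 : x 0 ≠ 0 := fun h2 => hx (by ext i; fin_cases i <;> simp [h1, h2])
      have := ha.ne'
      simp only [h1, mul_zero, add_zero, ne_eq, OfNat.ofNat_ne_zero, not_false_eq_true, zero_pow]
      positivity
    · positivity

theorem mem_Z_two_zero_iff (Γ : Z2) : Γ ∈ Z 2 0 ↔ 0 < ricciDet Γ ∧ ricci Γ 0 0 < 0 := by
  have h0 := sigNeg_le_two_sub (symRicci Γ).toQuadraticForm'
  have h1 : Γ ∈ Z 2 0 ↔ sigPos (-(symRicci Γ).toQuadraticForm') = 2 := by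
    rw [sigPos_neg]
    exact ⟨fun h => h.2.1, fun h => ⟨rfl, h, by omega⟩⟩
  rw [h1, sigPos_eq_two_iff]
  constructor
  · intro h
    have ha : ricci Γ 0 0 < 0 := by
      have := h ![1, 0] (by simp)
      simpa [symRicci_quadraticForm_apply] using this
    refine ⟨?_, ha⟩
    have := h ![-ricci Γ 0 1, ricci Γ 0 0] (by simp [ha.ne])
    simp only [neg_apply, symRicci_quadraticForm_apply, Matrix.cons_val_zero,
      Matrix.cons_val_one] at this
    refine pos_of_mul_pos_right (a := -ricci Γ 0 0) ?_ (by linarith)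
    rw [ricciDet]
    linarith
  · rintro ⟨hD, ha⟩ x hx
    rw [neg_apply, symRicci_quadraticForm_apply]
    refine pos_of_mul_pos_right (a := -ricci Γ 0 0) ?_ (by linarith)
    have e : -ricci Γ 0 0 * -(ricci Γ 0 0 * x 0 ^ 2 + 2 * ricci Γ 0 1 * (x 0 * x 1) +
        ricci Γ 1 1 * x 1 ^ 2) = (ricci Γ 0 0 * x 0 + ricci Γ 0 1 * x 1) ^ 2
          + ricciDet Γ * x 1 ^ 2 := by
      rw [ricciDet]
      ring
    rw [e]
    by_cases h1 : x 1 = 0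
    · have h2 : x 0 ≠ 0 := fun h2 => hx (by ext i; fin_cases i <;> simp [h1, h2])
      have := ha.ne
      simp only [h1, mul_zero, add_zero, ne_eq, OfNat.ofNat_ne_zero, not_false_eq_true, zero_pow]
      positivity
    · positivity

theorem mem_Z_one_one_iff (Γ : Z2) : Γ ∈ Z 1 1 ↔ ricciDet Γ < 0 := by
  have h0 := sigNeg_le_two_sub (symRicci Γ).toQuadraticForm'
  have h1 : Γ ∈ Z 1 1 ↔ 1 ≤ sigPos (symRicci Γ).toQuadraticForm' ∧
      1 ≤ sigPos (-(symRicci Γ).toQuadraticForm') := by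
    rw [sigPos_neg]
    exact ⟨fun h => ⟨h.2.2.ge, h.2.1.ge⟩, fun h => ⟨rfl, by omega, by omega⟩⟩
  rw [h1, one_le_sigPos_iff, one_le_sigPos_iff]
  simp only [neg_apply, symRicci_quadraticForm_apply, ricciDet]
  generalize ricci Γ 0 0 = p
  generalize ricci Γ 0 1 = q
  generalize ricci Γ 1 1 = r
  constructor
  · rintro ⟨⟨x, hx⟩, ⟨y, hy⟩⟩
    by_contra! hD
    rcases lt_trichotomy p 0 with hp | hp | hp
    · nlinarith [sq_nonneg (p * x 0 + q * x 1), mul_nonneg hD (sq_nonneg (x 1))]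
    · have hq : q = 0 := by
        rw [hp] at hD
        exact pow_eq_zero_iff two_ne_zero |>.1 (le_antisymm (by linarith) (sq_nonneg q))
      subst hp hq
      rcases le_total r 0 with hr | hr <;> nlinarith [sq_nonneg (x 1), sq_nonneg (y 1)]
    · nlinarith [sq_nonneg (p * y 0 + q * y 1), mul_nonneg hD (sq_nonneg (y 1))]
  · intro hD
    rcases lt_trichotomy p 0 with hp | hp | hp
    -- The form equals p(pr − q²) at (−q, p) and p at (1, 0), which have opposite signs. When p = 0,
    -- the witnesses below are chosen so that the form takes the values 1 and −1.
    · refine ⟨⟨![-q, p], ?_⟩, ⟨![1, 0], ?_⟩⟩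
      · simp
        nlinarith
      · simp [hp]
    · subst hp
      have hq : q ≠ 0 := by
        rintro rfl
        simp at hD
      refine ⟨⟨![(1 - r) / (2 * q), 1], ?_⟩, ⟨![(-1 - r) / (2 * q), 1], ?_⟩⟩
      · simp
        field_simp
        linarith
      · simp
        field_simp
        linarith
    · refine ⟨⟨![1, 0], ?_⟩, ⟨![-q, p], ?_⟩⟩
      · simp [hp]
      · simp
        nlinarith

/-! ### The linear action and its effect on the Ricci tensor and the trace form -/

/-- The determinant of an element of the group, in terms of its entries. -/
theorem det_pos (T : GL(2, ℝ)⁺) : 0 < T.1.1 0 0 * T.1.1 1 1 - T.1.1 0 1 * T.1.1 1 0 := by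
  have h : 0 < (T.1.1).det := T.2
  rwa [Matrix.det_fin_two] at h

theorem inv_entries (T : GL(2, ℝ)⁺) : (T⁻¹).1.1 =
    (T.1.1 0 0 * T.1.1 1 1 - T.1.1 0 1 * T.1.1 1 0)⁻¹ •
      !![T.1.1 1 1, -T.1.1 0 1; -T.1.1 1 0, T.1.1 0 0] := by
  have h : (T⁻¹).1.1 = (T.1.1)⁻¹ := Matrix.coe_units_inv T.1
  rw [h, Matrix.inv_def, Ring.inverse_eq_inv', Matrix.adjugate_fin_two, Matrix.det_fin_two]

theorem act_apply (T : GL(2, ℝ)⁺) (Γ : Z2) (i j k : Fin 2) :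
    (act T Γ).1 i j k = ∑ a, ∑ b, ∑ c, T.1.1 a i * T.1.1 b j * (T⁻¹).1.1 k c * Γ.1 a b c := rfl

theorem mul_inv_apply (T : GL(2, ℝ)⁺) (a b : Fin 2) :
    ∑ k, T.1.1 a k * (T⁻¹).1.1 k b = (1 : Matrix (Fin 2) (Fin 2) ℝ) a b := by
  have h : T.1.1 * (T⁻¹).1.1 = 1 := by
    rw [← Units.val_mul, ← Subgroup.coe_mul, mul_inv_cancel]
    rfl
  rw [← h, Matrix.mul_apply]

/-- The defining equations of the action, without inverse matrix. -/
theorem sum_mul_act (T : GL(2, ℝ)⁺) (Γ : Z2) (i j l : Fin 2) :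
    ∑ k, T.1.1 l k * (act T Γ).1 i j k = ∑ a, ∑ b, T.1.1 a i * T.1.1 b j * Γ.1 a b l := by
  revert l
  rw [Fin.forall_fin_two]
  have h00 := mul_inv_apply T 0 0
  have h01 := mul_inv_apply T 0 1
  have h10 := mul_inv_apply T 1 0
  have h11 := mul_inv_apply T 1 1
  simp only [act_apply, Fin.sum_univ_two, Matrix.one_apply, if_true, zero_ne_one, one_ne_zero,
    if_false] at *
  constructor
  · linear_combination (T.1.1 0 i * T.1.1 0 j * Γ.1 0 0 0 + T.1.1 0 i * T.1.1 1 j * Γ.1 0 1 0 +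
      T.1.1 1 i * T.1.1 0 j * Γ.1 1 0 0 + T.1.1 1 i * T.1.1 1 j * Γ.1 1 1 0) * h00 +
      (T.1.1 0 i * T.1.1 0 j * Γ.1 0 0 1 + T.1.1 0 i * T.1.1 1 j * Γ.1 0 1 1 +
      T.1.1 1 i * T.1.1 0 j * Γ.1 1 0 1 + T.1.1 1 i * T.1.1 1 j * Γ.1 1 1 1) * h01
  · linear_combination (T.1.1 0 i * T.1.1 0 j * Γ.1 0 0 0 + T.1.1 0 i * T.1.1 1 j * Γ.1 0 1 0 +
      T.1.1 1 i * T.1.1 0 j * Γ.1 1 0 0 + T.1.1 1 i * T.1.1 1 j * Γ.1 1 1 0) * h10 +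
      (T.1.1 0 i * T.1.1 0 j * Γ.1 0 0 1 + T.1.1 0 i * T.1.1 1 j * Γ.1 0 1 1 +
      T.1.1 1 i * T.1.1 0 j * Γ.1 1 0 1 + T.1.1 1 i * T.1.1 1 j * Γ.1 1 1 1) * h11

theorem ricci_act (T : GL(2, ℝ)⁺) (Γ : Z2) (j k : Fin 2) :
    ricci (act T Γ) j k = ∑ a, ∑ b, T.1.1 a j * T.1.1 b k * ricci Γ a b := by
  have hD := (det_pos T).ne'
  -- Tensoriality of the curvature with the upper index still multiplied by T: applying
  -- `sum_mul_act` twice avoids all denominators.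
  have h (i j k l : Fin 2) : ∑ m, T.1.1 l m * curvature (act T Γ) i j k m =
      ∑ a, ∑ b, ∑ c, T.1.1 a i * T.1.1 b j * T.1.1 c k * curvature Γ a b c l := by
    have e (n : Fin 2) := sum_mul_act T Γ i n l
    have e' (n : Fin 2) := sum_mul_act T Γ j n l
    have g (l : Fin 2) := sum_mul_act T Γ j k l
    have g' (l : Fin 2) := sum_mul_act T Γ i k l
    have e0 := e 0
    have e1 := e 1
    have e'0 := e' 0
    have e'1 := e' 1
    have g0 := g 0
    have g1 := g 1
    have g'0 := g' 0
    have g'1 := g' 1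
    simp only [curvature, Fin.sum_univ_two] at *
    linear_combination (act T Γ).1 j k 0 * e0 + (act T Γ).1 j k 1 * e1
      - (act T Γ).1 i k 0 * e'0 - (act T Γ).1 i k 1 * e'1
      + (T.1.1 0 i * Γ.1 0 0 l + T.1.1 1 i * Γ.1 1 0 l) * g0
      + (T.1.1 0 i * Γ.1 0 1 l + T.1.1 1 i * Γ.1 1 1 l) * g1
      - (T.1.1 0 j * Γ.1 0 0 l + T.1.1 1 j * Γ.1 1 0 l) * g'0
      - (T.1.1 0 j * Γ.1 0 1 l + T.1.1 1 j * Γ.1 1 1 l) * g'1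
  have h2 (i j k l : Fin 2) : curvature (act T Γ) i j k l = ∑ m, (T⁻¹).1.1 l m *
      ∑ a, ∑ b, ∑ c, T.1.1 a i * T.1.1 b j * T.1.1 c k * curvature Γ a b c m := by
    simp only [← h, inv_entries]
    fin_cases l <;> simp [Fin.sum_univ_two] <;> field_simp <;> ring
  simp only [ricci, h2]
  simp only [Fin.sum_univ_two, inv_entries] at *
  simp
  field_simp
  ring

theorem ricciDet_act (T : GL(2, ℝ)⁺) (Γ : Z2) : ricciDet (act T Γ) =
    (T.1.1 0 0 * T.1.1 1 1 - T.1.1 0 1 * T.1.1 1 0) ^ 2 * ricciDet Γ := by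
  simp only [ricciDet, ricci_act, Fin.sum_univ_two, ricci_one_zero]
  ring

theorem trace_act (T : GL(2, ℝ)⁺) (Γ : Z2) (j : Fin 2) :
    ∑ i, (act T Γ).1 j i i = ∑ a, T.1.1 a j * ∑ i, Γ.1 a i i := by
  have hD := (det_pos T).ne'
  simp only [act_apply, Fin.sum_univ_two, inv_entries]
  simp
  field_simp
  ring

/-- Build an element of the group from its entries. -/
def ofEntries (A : Fin 2 → Fin 2 → ℝ) (h : 0 < A 0 0 * A 1 1 - A 0 1 * A 1 0) : GL(2, ℝ)⁺ :=
  have h' : 0 < (Matrix.of A).det := by rwa [Matrix.det_fin_two]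
  ⟨Matrix.GeneralLinearGroup.mkOfDetNeZero (Matrix.of A) h'.ne', h'⟩

theorem ofEntries_apply (A : Fin 2 → Fin 2 → ℝ) (h : 0 < A 0 0 * A 1 1 - A 0 1 * A 1 0)
    (i j : Fin 2) : (ofEntries A h).1.1 i j = A i j := rfl

/-- A linear system with invertible coefficient matrix has at most one solution. -/
theorem eq_of_sum_mul_eq {A : Fin 2 → Fin 2 → ℝ} (h : A 0 0 * A 1 1 - A 0 1 * A 1 0 ≠ 0)
    {u v : Fin 2 → ℝ} (huv : ∀ l, ∑ k, A l k * u k = ∑ k, A l k * v k) : u = v := by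
  have h0 := huv 0
  have h1 := huv 1
  simp only [Fin.sum_univ_two] at h0 h1
  have e0 : u 0 = v 0 := mul_left_cancel₀ h (by linear_combination A 1 1 * h0 - A 0 1 * h1)
  have e1 : u 1 = v 1 := mul_left_cancel₀ h (by linear_combination A 0 0 * h1 - A 1 0 * h0)
  ext k
  fin_cases k
  · exact e0
  · exact e1

theorem act_eq_of_sum_mul (T : GL(2, ℝ)⁺) {Γ Γ' : Z2}
    (h : ∀ i j l, ∑ k, T.1.1 l k * Γ'.1 i j k = ∑ a, ∑ b, T.1.1 a i * T.1.1 b j * Γ.1 a b l) :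
    act T Γ = Γ' := by
  ext i j k
  refine congrFun (eq_of_sum_mul_eq (A := T.1.1) (det_pos T).ne' fun l => ?_) k
  rw [h, sum_mul_act]

/-! ### Affine maps between structures with non-degenerate Ricci tensor are linear -/

/-- In matrix form the hypothesis is F Cᵗ = Kᵗ F with F invertible, so Cᵗ and Kᵗ are similar. It is
used to contract the curvature identity to one for Ricci. -/
theorem trace_eq_of_intertwined {F C K : Fin 2 → Fin 2 → ℝ}
    (hF : F 0 0 * F 1 1 - F 0 1 * F 1 0 ≠ 0)
    (h : ∀ k l, ∑ n, F k n * C l n = ∑ a, F a l * K a k) : ∑ l, C l l = ∑ a, K a a := by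
  have h00 := h 0 0
  have h01 := h 0 1
  have h10 := h 1 0
  have h11 := h 1 1
  simp only [Fin.sum_univ_two] at *
  refine mul_left_cancel₀ hF ?_
  linear_combination F 1 1 * h00 - F 0 1 * h10 + F 0 0 * h11 - F 1 0 * h01

/-- The right hand side of the equation of an affine map between the connections. -/
def hessianRHS (Γ Γ' : Z2) (F : Fin 2 → Fin 2 → ℝ) (i j k : Fin 2) : ℝ :=
  ∑ c, F k c * Γ.1 i j c - ∑ a, ∑ b, Γ'.1 a b k * F a i * F b j

theorem hessianRHS_symm (Γ Γ' : Z2) (F : Fin 2 → Fin 2 → ℝ) (i j k : Fin 2) :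
    hessianRHS Γ Γ' F i j k = hessianRHS Γ Γ' F j i k := by
  simp only [hessianRHS, Fin.sum_univ_two, Γ.2 i j, Γ'.2 1 0]
  ring

section PDE

variable {Γ Γ' : Z2} {s : Set (Fin 2 → ℝ)} {F : Fin 2 → Fin 2 → (Fin 2 → ℝ) → ℝ}

theorem fderiv_hessianRHS (hs : IsOpen s)
    (hF : ∀ k j, ContDiffOn ℝ ∞ (F k j) s)
    (hP : ∀ x ∈ s, ∀ i j k, fderiv ℝ (F k j) x (Pi.single i 1) =
      hessianRHS Γ Γ' (fun a b => F a b x) i j k) {x : Fin 2 → ℝ} (hx : x ∈ s) (l i j k : Fin 2) :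
    fderiv ℝ (fun y => hessianRHS Γ Γ' (fun a b => F a b y) i j k) x (Pi.single l 1) =
      ∑ c, hessianRHS Γ Γ' (fun a b => F a b x) l c k * Γ.1 i j c -
        ∑ a, ∑ b, Γ'.1 a b k * (hessianRHS Γ Γ' (fun a b => F a b x) l i a * F b j x +
          F a i x * hessianRHS Γ Γ' (fun a b => F a b x) l j b) := by
  have hd (k j) : HasFDerivAt (F k j) (fderiv ℝ (F k j) x) x :=
    (((hF k j).contDiffAt (hs.mem_nhds hx)).differentiableAt (by simp)).hasFDerivAt
  have h1 : HasFDerivAt (fun y => hessianRHS Γ Γ' (fun a b => F a b y) i j k) _ x :=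
    (HasFDerivAt.fun_sum fun c _ => (hd k c).mul_const (Γ.1 i j c)).sub
      (HasFDerivAt.fun_sum fun a _ => HasFDerivAt.fun_sum fun b _ =>
        (((hd a i).const_mul (Γ'.1 a b k)).mul (hd b j)))
  rw [h1.fderiv]
  simp [hP x hx, Fin.sum_univ_two]
  ring

/-- The integrability condition of ∂F = FΓ − Γ'(F, F): equality of the mixed second derivatives of
F, with the equation substituted twice. -/
theorem curvature_intertwined (hs : IsOpen s)
    (hF : ∀ k j, ContDiffOn ℝ ∞ (F k j) s)
    (hP : ∀ x ∈ s, ∀ i j k, fderiv ℝ (F k j) x (Pi.single i 1) =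
      hessianRHS Γ Γ' (fun a b => F a b x) i j k) {x : Fin 2 → ℝ} (hx : x ∈ s) (l i j k : Fin 2) :
    ∑ n, F k n x * curvature Γ l i j n =
      ∑ a, F a l x * ∑ b, ∑ c, curvature Γ' a b c k * F b i x * F c j x := by
  have hsymm : fderiv ℝ (fun y => fderiv ℝ (F k j) y (Pi.single i 1)) x (Pi.single l 1) =
      fderiv ℝ (fun y => fderiv ℝ (F k j) y (Pi.single l 1)) x (Pi.single i 1) := by
    have hc : ContDiffAt ℝ ∞ (F k j) x := (hF k j).contDiffAt (hs.mem_nhds hx)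
    have hd : DifferentiableAt ℝ (fderiv ℝ (F k j)) x :=
      (hc.fderiv_right (m := 1) (by norm_cast)).differentiableAt (by simp)
    rw [fderiv_clm_apply hd (by fun_prop), fderiv_clm_apply hd (by fun_prop)]
    simpa using (hc.isSymmSndFDerivAt (by simp; norm_cast)).eq (Pi.single l 1) (Pi.single i 1)
  have he (i : Fin 2) : (fun y => fderiv ℝ (F k j) y (Pi.single i 1)) =ᶠ[𝓝 x]
      fun y => hessianRHS Γ Γ' (fun a b => F a b y) i j k := by
    filter_upwards [hs.mem_nhds hx] with y hy using hP y hy i j k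
  rw [(he i).fderiv_eq, (he l).fderiv_eq, fderiv_hessianRHS hs hF hP hx,
    fderiv_hessianRHS hs hF hP hx] at hsymm
  simp only [hessianRHS, curvature, Fin.sum_univ_two, Γ.2 i l, Γ'.2 1 0] at hsymm ⊢
  linear_combination hsymm

theorem ricci_intertwined (hs : IsOpen s)
    (hF : ∀ k j, ContDiffOn ℝ ∞ (F k j) s)
    (hdet : ∀ x ∈ s, F 0 0 x * F 1 1 x - F 0 1 x * F 1 0 x ≠ 0)
    (hP : ∀ x ∈ s, ∀ i j k, fderiv ℝ (F k j) x (Pi.single i 1) =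
      hessianRHS Γ Γ' (fun a b => F a b x) i j k) {x : Fin 2 → ℝ} (hx : x ∈ s) (i j : Fin 2) :
    ricci Γ i j = ∑ a, ∑ b, ricci Γ' a b * F a i x * F b j x := by
  have h := trace_eq_of_intertwined (F := fun a b => F a b x)
    (C := fun l n => curvature Γ l i j n)
    (K := fun a k => ∑ b, ∑ c, curvature Γ' a b c k * F b i x * F c j x) (hdet x hx)
    fun k l => curvature_intertwined hs hF hP hx l i j k
  rw [ricci, h]
  simp only [ricci, Fin.sum_univ_two]
  ring

/-- The algebra behind uniqueness of the Levi-Civita connection: a tensor symmetric in one pair of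
slots and antisymmetric in an overlapping pair vanishes. -/
theorem eq_zero_of_symm_of_antisymm {H : Fin 2 → Fin 2 → Fin 2 → ℝ}
    (h1 : ∀ l i j, H l i j = H i l j) (h2 : ∀ l i j, H l i j + H l j i = 0) (l i j : Fin 2) :
    H l i j = 0 := by
  have a1 := h1 l i j
  have a2 := h1 j l i
  have a3 := h1 i j l
  have b1 := h2 l i j
  have b2 := h2 j i l
  have b3 := h2 i j l
  linarith

/-- The pullback of ρ' by F is ρ, which has constant components. Its derivative gives antisymmetry
in (i, j) of ρ'(∂_l F_i, F_j), while ∂_l F_i is symmetric in (l, i). Hence ρ'(∂_l F_i, F_j) = 0, and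
invertibility of F and of ρ' gives ∂F = 0. -/
theorem hessianRHS_eq_zero (hs : IsOpen s)
    (hF : ∀ k j, ContDiffOn ℝ ∞ (F k j) s)
    (hdet : ∀ x ∈ s, F 0 0 x * F 1 1 x - F 0 1 x * F 1 0 x ≠ 0)
    (hP : ∀ x ∈ s, ∀ i j k, fderiv ℝ (F k j) x (Pi.single i 1) =
      hessianRHS Γ Γ' (fun a b => F a b x) i j k) (hΓ' : ricciDet Γ' ≠ 0)
    {x : Fin 2 → ℝ} (hx : x ∈ s) (l i a : Fin 2) :
    hessianRHS Γ Γ' (fun a b => F a b x) l i a = 0 := by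
  have hd (k j) : HasFDerivAt (F k j) (fderiv ℝ (F k j) x) x :=
    (((hF k j).contDiffAt (hs.mem_nhds hx)).differentiableAt (by simp)).hasFDerivAt
  have hH := eq_zero_of_symm_of_antisymm
    (H := fun l i j => ∑ b, F b j x *
      ∑ a, ricci Γ' a b * hessianRHS Γ Γ' (fun a b => F a b x) l i a)
    (fun l i j => by simp only [hessianRHS_symm Γ Γ' _ l i]) (fun l i j => by
      have h1 : HasFDerivAt (fun y => ∑ a, ∑ b, ricci Γ' a b * F a i y * F b j y) _ x :=
        (HasFDerivAt.fun_sum fun a _ => HasFDerivAt.fun_sum fun b _ =>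
          (((hd a i).const_mul (ricci Γ' a b)).mul (hd b j)))
      have h2 : (fun y => ∑ a, ∑ b, ricci Γ' a b * F a i y * F b j y) =ᶠ[𝓝 x]
          fun _ => ricci Γ i j := by
        filter_upwards [hs.mem_nhds hx] with y hy
        exact (ricci_intertwined hs hF hdet hP hy i j).symm
      have h3 := h2.fderiv_eq (𝕜 := ℝ)
      rw [h1.fderiv] at h3
      have h4 := congrArg (fun L : (Fin 2 → ℝ) →L[ℝ] ℝ => L (Pi.single l 1)) h3
      simp [hP x hx, Fin.sum_univ_two, ricci_one_zero] at h4
      simp only [Fin.sum_univ_two, ricci_one_zero]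
      linear_combination h4)
  have h1 (l i b : Fin 2) : ∑ a, ricci Γ' a b * hessianRHS Γ Γ' (fun a b => F a b x) l i a = 0 :=
    congrFun (eq_of_sum_mul_eq (A := fun j b => F b j x)
      (u := fun b => ∑ a, ricci Γ' a b * hessianRHS Γ Γ' (fun a b => F a b x) l i a) (v := 0)
      (by have := hdet x hx; contrapose! this; linear_combination this)
      fun j => by simpa using hH l i j) b
  refine congrFun (eq_of_sum_mul_eq (A := fun b a => ricci Γ' a b)
      (u := fun a => hessianRHS Γ Γ' (fun a b => F a b x) l i a) (v := 0)
      ?_ fun j => by simpa using h1 l i j) a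
  rw [ricci_one_zero]
  contrapose! hΓ'
  rw [ricciDet]
  linear_combination hΓ'

end PDE

theorem LocallyIsomorphic.exists_act_eq {Γ Γ' : Z2} (h : LocallyIsomorphic Γ Γ')
    (hΓ' : ricciDet Γ' ≠ 0) : ∃ T, act T Γ' = Γ := by
  obtain ⟨Φ, P, hPs, hΦ, hΦ', hdet, hn⟩ := h
  have hA : ContDiffOn ℝ ∞ (fderiv ℝ Φ) Φ.source := hΦ.fderiv_of_isOpen Φ.open_source (by simp)
  set F : Fin 2 → Fin 2 → (Fin 2 → ℝ) → ℝ := fun k c x => fderiv ℝ Φ x (Pi.single c 1) k with hFdef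
  have hF (k j) : ContDiffOn ℝ ∞ (F k j) Φ.source := by
    have : ContDiffOn ℝ ∞ (fun x => fderiv ℝ Φ x (Pi.single j 1)) Φ.source :=
      hA.clm_apply contDiffOn_const
    exact contDiffOn_pi.1 this k
  have hL (x) (v : Fin 2 → ℝ) (k) : fderiv ℝ Φ x v k = ∑ c, F k c x * v c := by
    conv_lhs => rw [pi_eq_sum_univ' v]
    simp [hFdef, mul_comm]
  have hdetF (x) : (fderiv ℝ Φ x).det = F 0 0 x * F 1 1 x - F 0 1 x * F 1 0 x := by
    rw [ContinuousLinearMap.det, ← LinearMap.det_toMatrix', Matrix.det_fin_two]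
    simp [LinearMap.toMatrix'_apply, hFdef]
  have hP : ∀ x ∈ Φ.source, ∀ i j k, fderiv ℝ (F k j) x (Pi.single i 1) =
      hessianRHS Γ Γ' (fun a b => F a b x) i j k := by
    intro x hx i j k
    -- The coordinate fields suffice: for them ∇^Γ is Γ itself, and the identity becomes the first
    -- order system for the Jacobian.
    have h1 := hn (fun _ => Pi.single i 1) (fun _ => Pi.single j 1) contDiffOn_const
      contDiffOn_const x hx
    have hΦx : DifferentiableAt ℝ Φ x :=
      (hΦ.contDiffAt (Φ.open_source.mem_nhds hx)).differentiableAt (by simp)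
    have hy : Φ x ∈ Φ.target := Φ.map_source hx
    have hΦy : DifferentiableAt ℝ Φ.symm (Φ x) :=
      (hΦ'.contDiffAt (Φ.open_target.mem_nhds hy)).differentiableAt (by simp)
    have hinv : fderiv ℝ Φ.symm (Φ x) (fderiv ℝ Φ x (Pi.single i 1)) = Pi.single i 1 := by
      have h2 : (Φ.symm ∘ Φ) =ᶠ[𝓝 x] id := by
        filter_upwards [Φ.open_source.mem_nhds hx] with y hy using Φ.left_inv hy
      have h3 := h2.fderiv_eq (𝕜 := ℝ)
      rw [fderiv_comp x hΦy hΦx, fderiv_id] at h3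
      exact congrArg (fun L : (Fin 2 → ℝ) →L[ℝ] (Fin 2 → ℝ) => L (Pi.single i 1)) h3
    have hAx : DifferentiableAt ℝ (fun z => fderiv ℝ Φ z (Pi.single j 1)) x :=
      ((hA.contDiffAt (Φ.open_source.mem_nhds hx)).differentiableAt (by simp)).clm_apply
        (by fun_prop)
    -- By the chain rule, differentiating the pushed-forward field along the pushed-forward vector
    -- amounts to differentiating the j-th column of the Jacobian along ∂_i.
    have h4 : fderiv ℝ (pushforward Φ fun _ => Pi.single j 1) (Φ x)
        (fderiv ℝ Φ x (Pi.single i 1)) k = fderiv ℝ (F k j) x (Pi.single i 1) := by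
      have e1 : pushforward Φ (fun _ => Pi.single j 1) =
          (fun z => fderiv ℝ Φ z (Pi.single j 1)) ∘ Φ.symm := rfl
      rw [e1, fderiv_comp (Φ x) (by rwa [Φ.left_inv hx]) hΦy, Φ.left_inv hx]
      rw [ContinuousLinearMap.comp_apply, hinv]
      have e2 := (hasFDerivAt_pi'.1 hAx.hasFDerivAt k).fderiv
      rw [hFdef, e2]
      rfl
    have h5 := congrFun h1 k
    rw [hL] at h5
    have h6 (c : Fin 2) : pushforward Φ (fun _ => Pi.single c 1) (Φ x) =
        fderiv ℝ Φ x (Pi.single c 1) := by rw [pushforward, Φ.left_inv hx]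
    simp only [nabla, h6] at h5
    rw [h4] at h5
    simp [Fin.sum_univ_two, Pi.single_apply] at h5
    simp only [hessianRHS, Fin.sum_univ_two]
    fin_cases i <;> fin_cases j <;> simp at h5 ⊢ <;> linarith
  have hdetF' : ∀ x ∈ Φ.source, F 0 0 x * F 1 1 x - F 0 1 x * F 1 0 x ≠ 0 := fun x hx => by
    rw [← hdetF]
    exact (hdet x hx).ne'
  -- Vanishing of the right hand side at the single point `P` is exactly the equation of the action
  -- for the Jacobian there.
  have h0 := hessianRHS_eq_zero Φ.open_source hF hdetF' hP hΓ' hPs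
  refine ⟨ofEntries (fun a b => F a b P) (by rw [← hdetF]; exact hdet P hPs),
    act_eq_of_sum_mul _ fun i j l => ?_⟩
  simp only [ofEntries_apply]
  have := h0 i j l
  simp only [hessianRHS, Fin.sum_univ_two] at this ⊢
  linear_combination this

/-- The isomorphism is the linear map x ↦ Tx: its derivative is constant, so only the Christoffel
terms have to match, and they do by `sum_mul_act`. -/
theorem locallyIsomorphic_act (T : GL(2, ℝ)⁺) (Γ : Z2) : LocallyIsomorphic (act T Γ) Γ := by
  let L : (Fin 2 → ℝ) ≃L[ℝ] (Fin 2 → ℝ) :=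
    (Matrix.toLin'OfInv (M := (T⁻¹).1.1) (M' := T.1.1)
      (by rw [← Units.val_mul, ← Subgroup.coe_mul, inv_mul_cancel]; rfl)
      (by rw [← Units.val_mul, ← Subgroup.coe_mul, mul_inv_cancel]; rfl)).toContinuousLinearEquiv
  have hL (v : Fin 2 → ℝ) (k : Fin 2) : L v k = ∑ c, T.1.1 k c * v c := by
    simp [L, Matrix.toLin'OfInv, Matrix.mulVec, dotProduct]
  have hfd (x) : fderiv ℝ (L.toHomeomorph.toOpenPartialHomeomorph) x = L := L.fderiv
  refine ⟨L.toHomeomorph.toOpenPartialHomeomorph, 0, trivial, L.contDiff.contDiffOn,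
    L.symm.contDiff.contDiffOn, fun x _ => ?_, fun ξ η hξ hη x _ => ?_⟩
  · rw [hfd]
    have : (L : (Fin 2 → ℝ) →L[ℝ] (Fin 2 → ℝ)).det = (T.1.1).det := by
      rw [ContinuousLinearMap.det, ← LinearMap.det_toLin' T.1.1]
      rfl
    rw [this]
    exact T.2
  · have hη' : DifferentiableAt ℝ η x :=
      (hη.contDiffAt Filter.univ_mem).differentiableAt (by simp)
    have hpush (ζ : (Fin 2 → ℝ) → Fin 2 → ℝ) :
        pushforward L.toHomeomorph.toOpenPartialHomeomorph ζ = fun y => L (ζ (L.symm y)) := by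
      ext1 y
      rw [pushforward, hfd]
      rfl
    have hx : L.symm (L x) = x := L.symm_apply_apply x
    have hd : HasFDerivAt (fun y => L (η (L.symm y)))
        ((L : (Fin 2 → ℝ) →L[ℝ] (Fin 2 → ℝ)).comp ((fderiv ℝ η x).comp
          (L.symm : (Fin 2 → ℝ) →L[ℝ] (Fin 2 → ℝ)))) (L x) := by
      have h1 : HasFDerivAt η (fderiv ℝ η x) (L.symm (L x)) := by
        rw [hx]
        exact hη'.hasFDerivAt
      exact L.hasFDerivAt.comp (L x) (h1.comp (L x) L.symm.hasFDerivAt)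
    have hLx : L.toHomeomorph.toOpenPartialHomeomorph x = L x := rfl
    rw [hpush, hpush, hfd, hLx]
    ext k
    simp only [nabla, hd.fderiv, hx, ContinuousLinearMap.comp_apply,
      ContinuousLinearEquiv.coe_coe, ContinuousLinearEquiv.symm_apply_apply]
    have hadd : L (nabla (act T Γ) ξ η x) k =
        L (fderiv ℝ η x (ξ x)) k +
          L (fun k => ∑ i, ∑ j, (act T Γ).1 i j k * ξ x i * η x j) k := by
      rw [← Pi.add_apply, ← map_add]
      rfl
    rw [hadd, hL (fun k => ∑ i, ∑ j, (act T Γ).1 i j k * ξ x i * η x j)]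
    have h (i j) := sum_mul_act T Γ i j k
    have h00 := h 0 0
    have h01 := h 0 1
    have h10 := h 1 0
    have h11 := h 1 1
    simp only [hL, Fin.sum_univ_two] at *
    linear_combination -ξ x 0 * η x 0 * h00 - ξ x 0 * η x 1 * h01 - ξ x 1 * η x 0 * h10
      - ξ x 1 * η x 1 * h11

/-! ### Slices of the action and equivariant charts -/

/-- The element of `𝒵(2)` with given Christoffel symbols
`Γ_{11}^1`, `Γ_{11}^2`, `Γ_{12}^1`, `Γ_{12}^2`, `Γ_{22}^1`, `Γ_{22}^2`. -/
def ofCoords (v : Fin 6 → ℝ) : Z2 :=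
  ⟨![![![v 0, v 1], ![v 2, v 3]], ![![v 2, v 3], ![v 4, v 5]]], by
    intro i j k
    fin_cases i <;> fin_cases j <;> rfl⟩

theorem Z2.ext_coords {Γ Γ' : Z2} (h0 : Γ.1 0 0 0 = Γ'.1 0 0 0) (h1 : Γ.1 0 0 1 = Γ'.1 0 0 1)
    (h2 : Γ.1 0 1 0 = Γ'.1 0 1 0) (h3 : Γ.1 0 1 1 = Γ'.1 0 1 1) (h4 : Γ.1 1 1 0 = Γ'.1 1 1 0)
    (h5 : Γ.1 1 1 1 = Γ'.1 1 1 1) : Γ = Γ' := by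
  have h6 := Γ.2 1 0
  have h7 := Γ'.2 1 0
  ext i j k
  revert i j k
  simp only [Fin.forall_fin_two]
  simp_all

/-- The six independent Christoffel symbols as linear coordinates. -/
def coords : Z2 ≃L[ℝ] (Fin 6 → ℝ) :=
  LinearEquiv.toContinuousLinearEquiv
    { toFun := fun Γ =>
        ![Γ.1 0 0 0, Γ.1 0 0 1, Γ.1 0 1 0, Γ.1 0 1 1, Γ.1 1 1 0, Γ.1 1 1 1]
      invFun := ofCoords
      map_add' := fun Γ Γ' => by
        ext i
        fin_cases i <;> rfl
      map_smul' := fun c Γ => by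
        ext i
        fin_cases i <;> rfl
      left_inv := fun Γ => by
        apply Z2.ext_coords <;> rfl
      right_inv := fun v => by
        ext i
        fin_cases i <;> rfl }

theorem finrank_Z2 : Module.finrank ℝ Z2 = 6 := by
  rw [coords.toLinearEquiv.finrank_eq]
  simp

/-- A Christoffel symbol as a continuous linear functional. -/
def symbol (i j k : Fin 2) : Z2 →L[ℝ] ℝ :=
  (ContinuousLinearMap.proj (R := ℝ) (φ := fun _ : Fin 2 => ℝ) k).comp
    ((ContinuousLinearMap.proj (R := ℝ) (φ := fun _ : Fin 2 => Fin 2 → ℝ) j).comp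
      ((ContinuousLinearMap.proj (R := ℝ) (φ := fun _ : Fin 2 => Fin 2 → Fin 2 → ℝ) i).comp
        Z2.subtypeL))

theorem symbol_apply (i j k : Fin 2) (Γ : Z2) : symbol i j k Γ = Γ.1 i j k := rfl

theorem contDiffAt_Z2 {X : Type*} [NormedAddCommGroup X] [NormedSpace ℝ X] {f : X → Z2} {x : X}
    {n : WithTop ℕ∞} (h : ∀ i j k, ContDiffAt ℝ n (fun y => (f y).1 i j k) x) :
    ContDiffAt ℝ n f x := by
  rw [← coords.comp_contDiffAt_iff, contDiffAt_pi]
  intro i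
  fin_cases i
  exacts [h 0 0 0, h 0 0 1, h 0 1 0, h 0 1 1, h 1 1 0, h 1 1 1]

/-- The action, in terms of the entries of the matrix. -/
def actEntries (A : Fin 2 → Fin 2 → ℝ) (Γ : Z2) : Z2 :=
  ⟨fun i j k => ∑ a, ∑ b, ∑ c, A a i * A b j *
    ((A 0 0 * A 1 1 - A 0 1 * A 1 0)⁻¹ * !![A 1 1, -A 0 1; -A 1 0, A 0 0] k c) * Γ.1 a b c, by
    intro i j k
    simp only [Fin.sum_univ_two, Γ.2 1 0]
    ring⟩

theorem actEntries_entries (T : GL(2, ℝ)⁺) (Γ : Z2) : actEntries (entries T) Γ = act T Γ := by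
  ext i j k
  simp only [act_apply, inv_entries, actEntries, entries, Matrix.smul_apply, smul_eq_mul]

theorem range_entries : Set.range entries = {A | 0 < A 0 0 * A 1 1 - A 0 1 * A 1 0} := by
  ext A
  constructor
  · rintro ⟨T, rfl⟩
    exact det_pos T
  · intro hA
    exact ⟨ofEntries A hA, rfl⟩

theorem contDiffAt_entry {i j : Fin 2} {A : Fin 2 → Fin 2 → ℝ} {n : WithTop ℕ∞} :
    ContDiffAt ℝ n (fun A : Fin 2 → Fin 2 → ℝ => A i j) A :=
  contDiffAt_pi.1 (contDiffAt_pi.1 contDiffAt_id i) j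

/-- The family of orbit maps along a map `s` from the plane to `𝒵(2)`. -/
def sweep (s : EuclideanSpace ℝ (Fin 2) → Z2) (p : EuclideanSpace ℝ (Fin 2) × (Fin 2 → Fin 2 → ℝ)) :
    Z2 :=
  actEntries p.2 (s p.1)

section Slice

variable {s : EuclideanSpace ℝ (Fin 2) → Z2}

theorem contDiffAt_sweep (hs : ContDiff ℝ ω s)
    {p : EuclideanSpace ℝ (Fin 2) × (Fin 2 → Fin 2 → ℝ)} (hp : p.2 ∈ Set.range entries) :
    ContDiffAt ℝ ω (sweep s) p := by
  rw [range_entries] at hp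
  have hA (i j) : ContDiffAt ℝ ω
      (fun p : EuclideanSpace ℝ (Fin 2) × (Fin 2 → Fin 2 → ℝ) => p.2 i j) p :=
    contDiffAt_entry.comp p contDiffAt_snd
  have hS (i j k) : ContDiffAt ℝ ω
      (fun p : EuclideanSpace ℝ (Fin 2) × (Fin 2 → Fin 2 → ℝ) => (s p.1).1 i j k) p :=
    (symbol i j k).contDiff.contDiffAt.comp p (hs.contDiffAt.comp p contDiffAt_fst)
  have hD : ContDiffAt ℝ ω (fun p : EuclideanSpace ℝ (Fin 2) × (Fin 2 → Fin 2 → ℝ) =>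
      (p.2 0 0 * p.2 1 1 - p.2 0 1 * p.2 1 0)⁻¹) p :=
    (((hA 0 0).mul (hA 1 1)).sub ((hA 0 1).mul (hA 1 0))).inv hp.ne'
  have hadj (k c : Fin 2) : ContDiffAt ℝ ω
      (fun p : EuclideanSpace ℝ (Fin 2) × (Fin 2 → Fin 2 → ℝ) =>
        !![p.2 1 1, -p.2 0 1; -p.2 1 0, p.2 0 0] k c) p := by
    fin_cases k <;> fin_cases c
    exacts [hA 1 1, (hA 0 1).neg, (hA 1 0).neg, hA 0 0]
  refine contDiffAt_Z2 fun i j k => ?_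
  change ContDiffAt ℝ ω (fun p : EuclideanSpace ℝ (Fin 2) × (Fin 2 → Fin 2 → ℝ) =>
    ∑ a, ∑ b, ∑ c, p.2 a i * p.2 b j * ((p.2 0 0 * p.2 1 1 - p.2 0 1 * p.2 1 0)⁻¹ *
      !![p.2 1 1, -p.2 0 1; -p.2 1 0, p.2 0 0] k c) * (s p.1).1 a b c) p
  exact ContDiffAt.sum fun a _ => ContDiffAt.sum fun b _ => ContDiffAt.sum fun c _ =>
    (((hA a i).mul (hA b j)).mul (hD.mul (hadj k c))).mul (hS a b c)

/-- The map `s` is infinitesimally transverse to the orbits at `v`. -/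
def InfinitesimallyTransverse (s : EuclideanSpace ℝ (Fin 2) → Z2)
    (v : EuclideanSpace ℝ (Fin 2)) : Prop :=
  ∀ (δ : EuclideanSpace ℝ (Fin 2)) (Y : Fin 2 → Fin 2 → ℝ),
    (∀ i j l, (fderiv ℝ s v δ).1 i j l + ∑ a, Y a i * (s v).1 a j l + ∑ b, Y b j * (s v).1 i b l =
      ∑ m, Y l m * (s v).1 i j m) → δ = 0 ∧ Y = 0

/-- Infinitesimal transversality is a condition at the identity of the group; equivariance
transports it to every g. The differentiated relation is `sum_mul_act`, in which no inverse matrix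
occurs. -/
theorem fderiv_sweep_injective (hs : ContDiff ℝ ω s) {v : EuclideanSpace ℝ (Fin 2)}
    (hv : InfinitesimallyTransverse s v) (T : GL(2, ℝ)⁺) :
    Function.Injective (fderiv ℝ (sweep s) (v, entries T)) := by
  rw [injective_iff_map_eq_zero]
  rintro ⟨δ, X⟩ h0
  have hD := (det_pos T).ne'
  have hT : entries T ∈ Set.range entries := ⟨T, rfl⟩
  have hf := ((contDiffAt_sweep hs (p := (v, entries T)) hT).differentiableAt (by simp)).hasFDerivAt
  have hsv : HasFDerivAt s (fderiv ℝ s v) v := (hs.differentiable (by simp) v).hasFDerivAt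
  have hfs (i j k) : HasFDerivAt (fun p => (sweep s p).1 i j k) _ (v, entries T) :=
    (symbol i j k).hasFDerivAt.comp (v, entries T) hf
  have hss (i j k) : HasFDerivAt
      (fun p : EuclideanSpace ℝ (Fin 2) × (Fin 2 → Fin 2 → ℝ) => (s p.1).1 i j k) _
      (v, entries T) :=
    (symbol i j k).hasFDerivAt.comp (v, entries T) (hsv.comp (v, entries T) hasFDerivAt_fst)
  have hA (i j) : HasFDerivAt
      (fun p : EuclideanSpace ℝ (Fin 2) × (Fin 2 → Fin 2 → ℝ) => p.2 i j) _ (v, entries T) :=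
    ((ContinuousLinearMap.proj (R := ℝ) (φ := fun _ : Fin 2 => ℝ) j).comp
      ((ContinuousLinearMap.proj (R := ℝ) (φ := fun _ : Fin 2 => Fin 2 → ℝ) i).comp
        (ContinuousLinearMap.snd ℝ (EuclideanSpace ℝ (Fin 2)) (Fin 2 → Fin 2 → ℝ)))).hasFDerivAt
  have key (i j l) : ∑ k, X l k * (act T (s v)).1 i j k =
      ∑ a, ∑ b, (X a i * T.1.1 b j * (s v).1 a b l + T.1.1 a i * X b j * (s v).1 a b l +
        T.1.1 a i * T.1.1 b j * (fderiv ℝ s v δ).1 a b l) := by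
    have h1 : HasFDerivAt (fun p : EuclideanSpace ℝ (Fin 2) × (Fin 2 → Fin 2 → ℝ) =>
        ∑ k, p.2 l k * (sweep s p).1 i j k) _ (v, entries T) :=
      HasFDerivAt.fun_sum fun k _ => (hA l k).mul (hfs i j k)
    have h2 : HasFDerivAt (fun p : EuclideanSpace ℝ (Fin 2) × (Fin 2 → Fin 2 → ℝ) =>
        ∑ a, ∑ b, p.2 a i * p.2 b j * (s p.1).1 a b l) _ (v, entries T) :=
      HasFDerivAt.fun_sum fun a _ => HasFDerivAt.fun_sum fun b _ =>
        ((hA a i).mul (hA b j)).mul (hss a b l)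
    have h3 : (fun p : EuclideanSpace ℝ (Fin 2) × (Fin 2 → Fin 2 → ℝ) =>
        ∑ k, p.2 l k * (sweep s p).1 i j k) =ᶠ[𝓝 (v, entries T)]
        fun p => ∑ a, ∑ b, p.2 a i * p.2 b j * (s p.1).1 a b l := by
      filter_upwards [(isOpenEmbedding_entries.isOpen_range.preimage continuous_snd).mem_nhds hT]
      rintro ⟨w, _⟩ ⟨g, rfl⟩
      simp only [sweep, actEntries_entries]
      exact sum_mul_act g (s w) i j l
    have h4 := h3.fderiv_eq (𝕜 := ℝ)
    rw [h1.fderiv, h2.fderiv] at h4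
    have h5 := congrArg (fun L : EuclideanSpace ℝ (Fin 2) × (Fin 2 → Fin 2 → ℝ) →L[ℝ] ℝ =>
      L (δ, X)) h4
    simp [h0, symbol_apply, Fin.sum_univ_two, sweep, actEntries_entries] at h5
    simp only [entries] at h5
    simp only [Fin.sum_univ_two]
    linear_combination h5
  -- The tangent vector X at T is written as YT, with Y tangent at the identity.
  set Y : Fin 2 → Fin 2 → ℝ := fun a m => ∑ i, X a i * (T⁻¹).1.1 i m with hY
  have hX (a i) : X a i = ∑ m, Y a m * T.1.1 m i := by
    simp only [hY, inv_entries, Fin.sum_univ_two, Matrix.smul_apply, smul_eq_mul]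
    fin_cases i <;> simp <;> field_simp <;> ring
  have hYX : Y = 0 → X = 0 := fun h => by
    ext a i
    simp [hX, h]
  refine Prod.mk_eq_zero.2 (And.imp_right hYX (hv δ Y ?_))
  set R : Fin 2 → Fin 2 → Fin 2 → ℝ := fun i j l =>
    (fderiv ℝ s v δ).1 i j l + ∑ a, Y a i * (s v).1 a j l + ∑ b, Y b j * (s v).1 i b l -
      ∑ m, Y l m * (s v).1 i j m with hR
  -- The defect R of the infinitesimal equation vanishes after pulling back both lower indices by T;
  -- they are cancelled one at a time.
  have hRT (i j l) : ∑ a, T.1.1 a i * ∑ b, T.1.1 b j * R a b l = 0 := by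
    have h6 := key i j l
    have h7 (m) := sum_mul_act T (s v) i j m
    have h70 := h7 0
    have h71 := h7 1
    simp only [hX, Fin.sum_univ_two] at h6 h70 h71
    simp only [hR, Fin.sum_univ_two]
    linear_combination -h6 + Y l 0 * h70 + Y l 1 * h71
  have hD' : T.1.1 0 0 * T.1.1 1 1 - T.1.1 1 0 * T.1.1 0 1 ≠ 0 := by
    rwa [mul_comm (T.1.1 1 0)]
  have hRT' (a j l) : ∑ b, T.1.1 b j * R a b l = 0 :=
    congrFun (eq_of_sum_mul_eq (A := fun i a => T.1.1 a i) (v := 0)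
      (u := fun a => ∑ b, T.1.1 b j * R a b l) hD' fun i => by simpa using hRT i j l) a
  have hR0 (a b l) : R a b l = 0 :=
    congrFun (eq_of_sum_mul_eq (A := fun i a => T.1.1 a i) (v := 0)
      (u := fun b => R a b l) hD' fun j => by simpa using hRT' a j l) b
  intro i j l
  exact sub_eq_zero.1 (hR0 i j l)

/-- An injective derivative is invertible by dimension: 2 + 4 = 6. -/
theorem exists_hasStrictFDerivAt_sweep (hs : ContDiff ℝ ω s) {v : EuclideanSpace ℝ (Fin 2)}
    (hv : InfinitesimallyTransverse s v) (T : GL(2, ℝ)⁺) :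
    ∃ L : (EuclideanSpace ℝ (Fin 2) × (Fin 2 → Fin 2 → ℝ)) ≃L[ℝ] Z2,
      HasStrictFDerivAt (sweep s)
        (L : (EuclideanSpace ℝ (Fin 2) × (Fin 2 → Fin 2 → ℝ)) →L[ℝ] Z2) (v, entries T) := by
  let L := LinearMap.linearEquivOfInjective
    (fderiv ℝ (sweep s) (v, entries T)).toLinearMap (fderiv_sweep_injective hs hv T)
    (by simp [finrank_Z2, Module.finrank_pi_fintype])
  refine ⟨L.toContinuousLinearEquiv, ?_⟩
  have h : (L.toContinuousLinearEquiv :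
      (EuclideanSpace ℝ (Fin 2) × (Fin 2 → Fin 2 → ℝ)) →L[ℝ] Z2) =
      fderiv ℝ (sweep s) (v, entries T) := by
    refine ContinuousLinearMap.ext fun x => ?_
    rfl
  rw [h]
  exact (contDiffAt_sweep hs ⟨T, rfl⟩).hasStrictFDerivAt (by simp)

/-- An equivariant real-analytic chart of an open part of `𝒵(2)`. -/
structure SliceChart where
  toChart : OpenPartialHomeomorph (EuclideanSpace ℝ (Fin 2) × GL(2, ℝ)⁺) Z2
  base : Set (EuclideanSpace ℝ (Fin 2))
  source_eq : toChart.source = base ×ˢ Set.univ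
  equivariant : ∀ v ∈ base, ∀ g h, toChart (v, g * h) = act h (toChart (v, g))
  contMDiffOn : ContMDiffOn ((𝓡 2).prod 𝓘(ℝ, Fin 2 → Fin 2 → ℝ)) 𝓘(ℝ, Z2) ω toChart toChart.source
  contMDiffOn_symm : ContMDiffOn 𝓘(ℝ, Z2) ((𝓡 2).prod 𝓘(ℝ, Fin 2 → Fin 2 → ℝ)) ω
    toChart.symm toChart.target

theorem contMDiff_entries :
    ContMDiff 𝓘(ℝ, Fin 2 → Fin 2 → ℝ) 𝓘(ℝ, Fin 2 → Fin 2 → ℝ) ω entries :=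
  contMDiff_isOpenEmbedding isOpenEmbedding_entries

/-- The inverse function theorem: a transverse map which meets every orbit at most once, with
trivial isotropy, defines an equivariant chart. -/
theorem exists_sliceChart (hs : ContDiff ℝ ω s) {V : Set (EuclideanSpace ℝ (Fin 2))}
    (hV : IsOpen V) (htrans : ∀ v ∈ V, InfinitesimallyTransverse s v)
    (hinj : ∀ v ∈ V, ∀ w ∈ V, ∀ g, act g (s v) = s w → g = 1 ∧ v = w) :
    ∃ S : SliceChart, S.base = V ∧ ∀ v g, S.toChart (v, g) = act g (s v) := by
  have hI : Set.InjOn (sweep s) (V ×ˢ Set.range entries) := by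
    rintro ⟨v, _⟩ ⟨hv, ⟨g, rfl⟩⟩ ⟨w, _⟩ ⟨hw, ⟨h, rfl⟩⟩ he
    simp only [sweep, actEntries_entries] at he
    have h1 : act (g * h⁻¹) (s v) = s w := by
      rw [act_mul, he, ← act_mul, mul_inv_cancel, act_one]
    obtain ⟨h2, rfl⟩ := hinj v hv w hw _ h1
    rw [mul_inv_eq_one.1 h2]
  have hO : IsOpen (V ×ˢ Set.range entries) := hV.prod isOpenEmbedding_entries.isOpen_range
  let e₀ : OpenPartialHomeomorph (EuclideanSpace ℝ (Fin 2) × (Fin 2 → Fin 2 → ℝ)) Z2 :=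
    OpenPartialHomeomorph.ofContinuousOpenRestrict hI.toPartialEquiv
      (fun p hp => (contDiffAt_sweep hs hp.2).continuousAt.continuousWithinAt)
      (by
        -- The restricted map is open because its strict derivative is invertible at each point;
        -- with injectivity this makes it a homeomorphism onto an open set.
        rw [isOpenMap_iff_nhds_le]
        rintro ⟨⟨v, A⟩, hv, g, hg⟩
        change entries g = A at hg
        subst hg
        obtain ⟨L, hL⟩ := exists_hasStrictFDerivAt_sweep hs (htrans v hv) g
        have h1 := hL.map_nhds_eq_of_equiv
        change 𝓝 (sweep s (v, entries g)) ≤ _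
        rw [← h1, ← map_nhds_subtype_coe_eq_nhds (p := fun x => x ∈ V ×ˢ Set.range entries)
          ⟨hv, ⟨g, rfl⟩⟩ (hO.mem_nhds ⟨hv, ⟨g, rfl⟩⟩), Filter.map_map]
        rfl) hO
  have he₀ : ContDiffOn ℝ ω e₀ e₀.source :=
    fun p hp => (contDiffAt_sweep hs hp.2).contDiffWithinAt
  have he₀' : ContDiffOn ℝ ω e₀.symm e₀.target := by
    intro y hy
    have hp : e₀.symm y ∈ V ×ˢ Set.range entries := e₀.map_target hy
    obtain ⟨hv, g, hg⟩ := hp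
    obtain ⟨L, hL⟩ := exists_hasStrictFDerivAt_sweep hs (htrans _ hv) g
    have h1 : ((e₀.symm y).1, entries g) = e₀.symm y := Prod.ext rfl hg
    rw [h1] at hL
    exact (e₀.contDiffAt_symm hy hL.hasFDerivAt
      (contDiffAt_sweep hs ⟨g, hg⟩)).contDiffWithinAt
  let ι := isOpenEmbedding_entries.toOpenPartialHomeomorph
  let e := ((OpenPartialHomeomorph.refl (EuclideanSpace ℝ (Fin 2))).prod ι).trans e₀
  have hap (v g) : e (v, g) = act g (s v) := actEntries_entries g (s v)
  refine ⟨⟨e, V, ?_, fun v _ g h => ?_, ?_, ?_⟩, rfl, hap⟩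
  · ext ⟨v, g⟩
    simp [e, ι, e₀, OpenPartialHomeomorph.ofContinuousOpenRestrict]
  · rw [hap, hap, act_mul]
  · have h1 : ContMDiff ((𝓡 2).prod 𝓘(ℝ, Fin 2 → Fin 2 → ℝ))
        𝓘(ℝ, EuclideanSpace ℝ (Fin 2) × (Fin 2 → Fin 2 → ℝ)) ω
        (fun p : EuclideanSpace ℝ (Fin 2) × GL(2, ℝ)⁺ => (p.1, entries p.2)) :=
      contMDiff_fst.prodMk_space (contMDiff_entries.comp contMDiff_snd)
    exact he₀.contMDiffOn.comp h1.contMDiffOn fun p hp => hp.2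
  · have h1 : ContMDiffOn 𝓘(ℝ, Z2) 𝓘(ℝ, EuclideanSpace ℝ (Fin 2) × (Fin 2 → Fin 2 → ℝ)) ω
        e₀.symm e.target := he₀'.contMDiffOn.mono fun y hy => hy.1
    have h2 : ContMDiffOn 𝓘(ℝ, Fin 2 → Fin 2 → ℝ) 𝓘(ℝ, Fin 2 → Fin 2 → ℝ) ω ι.symm
        (Set.range entries) := contMDiffOn_isOpenEmbedding_symm isOpenEmbedding_entries
    refine ContMDiffOn.prodMk (contDiff_fst.contMDiff.comp_contMDiffOn h1)
      (h2.comp (contDiff_snd.contMDiff.comp_contMDiffOn h1) fun y hy => ?_)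
    exact (e₀.map_target hy.1).2

end Slice

namespace SliceChart

variable (S : SliceChart)

theorem mem_source {v : EuclideanSpace ℝ (Fin 2)} (hv : v ∈ S.base) (g : GL(2, ℝ)⁺) :
    (v, g) ∈ S.toChart.source := by
  rw [S.source_eq]
  exact ⟨hv, trivial⟩

theorem isOpen_base : IsOpen S.base := by
  have h : S.base = (fun v => (v, (1 : GL(2, ℝ)⁺))) ⁻¹' S.toChart.source := by
    ext v
    simp [S.source_eq]
  rw [h]
  exact S.toChart.open_source.preimage (by fun_prop)

theorem symm_fst_mem {Γ : Z2} (hΓ : Γ ∈ S.toChart.target) : (S.toChart.symm Γ).1 ∈ S.base := by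
  have h := S.toChart.map_target hΓ
  rw [S.source_eq] at h
  exact h.1

theorem act_eq {Γ : Z2} (hΓ : Γ ∈ S.toChart.target) (g : GL(2, ℝ)⁺) :
    act g Γ = S.toChart ((S.toChart.symm Γ).1, (S.toChart.symm Γ).2 * g) := by
  rw [S.equivariant _ (S.symm_fst_mem hΓ), Prod.mk.eta, S.toChart.right_inv hΓ]

theorem act_mem_target {Γ : Z2} (hΓ : Γ ∈ S.toChart.target) (g : GL(2, ℝ)⁺) :
    act g Γ ∈ S.toChart.target := by
  rw [S.act_eq hΓ]
  exact S.toChart.map_source (S.mem_source (S.symm_fst_mem hΓ) _)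

/-- In the chart the group acts by right translation on the second factor. So the first factor is an
orbit invariant, and the action is free on the target. -/
theorem symm_act {Γ : Z2} (hΓ : Γ ∈ S.toChart.target) (g : GL(2, ℝ)⁺) :
    S.toChart.symm (act g Γ) = ((S.toChart.symm Γ).1, (S.toChart.symm Γ).2 * g) := by
  rw [S.act_eq hΓ, S.toChart.left_inv (S.mem_source (S.symm_fst_mem hΓ) _)]

theorem isotropy_eq_bot {Γ : Z2} (hΓ : Γ ∈ S.toChart.target) : isotropy Γ = ⊥ := by
  rw [Subgroup.eq_bot_iff_forall]
  intro T hT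
  have h := S.symm_act hΓ T
  rw [show act T Γ = Γ from hT] at h
  exact mul_eq_left.1 (congrArg Prod.snd h).symm

end SliceChart

/-! ### The quotient surface and its principal bundle -/

section Quotient

variable {B : Type} {N : Set Z2} {π : N → B}

/-- The fibres of `π` are the orbits. -/
def FibresAreOrbits (π : N → B) : Prop := ∀ x y : N, π x = π y ↔ ∃ g, act g x.1 = y.1

/-- The slice coordinates on the quotient. -/
def quotientCoord (hπ : Function.Surjective π) (S : SliceChart) (b : B) :
    EuclideanSpace ℝ (Fin 2) :=
  (S.toChart.symm (Function.surjInv hπ b).1).1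

theorem quotientCoord_apply (hπ : Function.Surjective π) (hfib : FibresAreOrbits π)
    (S : SliceChart) {x : N} (hx : x.1 ∈ S.toChart.target) :
    quotientCoord hπ S (π x) = (S.toChart.symm x.1).1 := by
  obtain ⟨g, hg⟩ := (hfib x (Function.surjInv hπ (π x))).1 (Function.surjInv_eq hπ (π x)).symm
  rw [quotientCoord, ← hg, S.symm_act hx]

/-- The point of the slice with given coordinates. -/
def SliceChart.point (S : SliceChart) (hSN : S.toChart.target ⊆ N)
    (v : S.base) : N :=
  ⟨S.toChart (v.1, 1), hSN (S.toChart.map_source (S.mem_source v.2 1))⟩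

open Classical in
/-- The map from slice coordinates to the quotient; off the base it takes an irrelevant value. -/
def quotientPoint (π : N → B) (S : SliceChart) (hSN : S.toChart.target ⊆ N) (b₀ : B)
    (v : EuclideanSpace ℝ (Fin 2)) : B :=
  if h : v ∈ S.base then π (S.point hSN ⟨v, h⟩) else b₀

theorem quotientPoint_apply (S : SliceChart) (hSN : S.toChart.target ⊆ N) (b₀ : B)
    (v : S.base) : quotientPoint π S hSN b₀ v = π (S.point hSN v) := by
  simp [quotientPoint]

theorem mem_target_of_eq (hfib : FibresAreOrbits π) (S : SliceChart) {x y : N} (h : π x = π y)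
    (hx : x.1 ∈ S.toChart.target) : y.1 ∈ S.toChart.target := by
  obtain ⟨g, hg⟩ := (hfib x y).1 h
  rw [← hg]
  exact S.act_mem_target hx g

theorem quotientPoint_symm (hfib : FibresAreOrbits π) (S : SliceChart)
    (hSN : S.toChart.target ⊆ N) (b₀ : B) {x : N} (hx : x.1 ∈ S.toChart.target) :
    quotientPoint π S hSN b₀ (S.toChart.symm x.1).1 = π x := by
  rw [quotientPoint_apply S hSN b₀ ⟨_, S.symm_fst_mem hx⟩, hfib]
  refine ⟨(S.toChart.symm x.1).2, ?_⟩
  rw [SliceChart.point, ← S.equivariant _ (S.symm_fst_mem hx), one_mul, Prod.mk.eta,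
    S.toChart.right_inv hx]

variable [TopologicalSpace B]

/-- The chart of the quotient defined by a slice. -/
def quotientChart (hπ : Function.Surjective π) (hcont : Continuous π) (hopen : IsOpenMap π)
    (hfib : FibresAreOrbits π) (S : SliceChart) (hSN : S.toChart.target ⊆ N) (b₀ : B) :
    OpenPartialHomeomorph B (EuclideanSpace ℝ (Fin 2)) where
  toFun := quotientCoord hπ S
  invFun := quotientPoint π S hSN b₀
  source := π '' (Subtype.val ⁻¹' S.toChart.target)
  target := S.base
  map_source' := by
    rintro _ ⟨x, hx, rfl⟩
    rw [quotientCoord_apply hπ hfib S hx]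
    exact S.symm_fst_mem hx
  map_target' := fun v hv => by
    rw [quotientPoint_apply S hSN b₀ ⟨v, hv⟩]
    exact ⟨_, S.toChart.map_source (S.mem_source hv 1), rfl⟩
  left_inv' := by
    rintro _ ⟨x, hx, rfl⟩
    rw [quotientCoord_apply hπ hfib S hx, quotientPoint_symm hfib S hSN b₀ hx]
  right_inv' := fun v hv => by
    have h := S.mem_source hv 1
    rw [quotientPoint_apply S hSN b₀ ⟨v, hv⟩,
      quotientCoord_apply hπ hfib S (x := S.point hSN ⟨v, hv⟩) (S.toChart.map_source h),
      SliceChart.point, S.toChart.left_inv h]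
  open_source := hopen _ (S.toChart.open_target.preimage continuous_subtype_val)
  open_target := S.isOpen_base
  continuousOn_toFun := by
    rintro _ ⟨x, hx, rfl⟩
    refine ContinuousAt.continuousWithinAt ?_
    rw [ContinuousAt, quotientCoord_apply hπ hfib S hx]
    refine Filter.Tendsto.mono_left ?_ (hopen.nhds_le x)
    rw [Filter.tendsto_map'_iff]
    have h1 : Filter.Tendsto (fun y : N => (S.toChart.symm y.1).1) (𝓝 x)
        (𝓝 (S.toChart.symm x.1).1) :=
      (continuous_fst.continuousAt.comp (S.toChart.continuousAt_symm hx)).comp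
        (f := Subtype.val) continuous_subtype_val.continuousAt
    refine h1.congr' ?_
    filter_upwards [(S.toChart.open_target.preimage continuous_subtype_val).mem_nhds hx] with y hy
    exact (quotientCoord_apply hπ hfib S hy).symm
  continuousOn_invFun := by
    rw [continuousOn_iff_continuous_domRestrict]
    have h1 : Continuous (S.point hSN) := by
      refine Continuous.subtype_mk ?_ _
      exact S.toChart.continuousOn.comp_continuous (by fun_prop) fun v => S.mem_source v.2 1
    convert! hcont.comp h1 using 1
    ext v
    exact quotientPoint_apply S hSN b₀ v

/-- The transition map is v ↦ `(S'.toChart.symm (S.toChart (v, 1))).1`, a composition of analytic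
maps. -/
theorem contDiffOn_transition (hπ : Function.Surjective π) (hcont : Continuous π)
    (hopen : IsOpenMap π) (hfib : FibresAreOrbits π) (S S' : SliceChart)
    (hSN : S.toChart.target ⊆ N) (hSN' : S'.toChart.target ⊆ N) (b₀ b₀' : B) :
    ContDiffOn ℝ ω (quotientChart hπ hcont hopen hfib S' hSN' b₀' ∘
        (quotientChart hπ hcont hopen hfib S hSN b₀).symm)
      ((quotientChart hπ hcont hopen hfib S hSN b₀).symm ≫ₕ
        quotientChart hπ hcont hopen hfib S' hSN' b₀').source := by
  have hmem : ∀ v ∈ ((quotientChart hπ hcont hopen hfib S hSN b₀).symm ≫ₕ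
        quotientChart hπ hcont hopen hfib S' hSN' b₀').source,
      v ∈ S.base ∧ S.toChart (v, 1) ∈ S'.toChart.target := by
    rintro v ⟨hv, hv'⟩
    obtain ⟨y, hy, he⟩ := hv'
    change π y = quotientPoint π S hSN b₀ v at he
    have hv : v ∈ S.base := hv
    rw [quotientPoint_apply S hSN b₀ ⟨v, hv⟩] at he
    exact ⟨hv, mem_target_of_eq hfib S' he hy⟩
  rw [← contMDiffOn_iff_contDiffOn]
  have h1 : ContMDiff (𝓡 2) ((𝓡 2).prod 𝓘(ℝ, Fin 2 → Fin 2 → ℝ)) ω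
      (fun v : EuclideanSpace ℝ (Fin 2) => (v, (1 : GL(2, ℝ)⁺))) :=
    contMDiff_id.prodMk contMDiff_const
  have h2 := contMDiff_fst.comp_contMDiffOn (S'.contMDiffOn_symm.comp
    (S.contMDiffOn.comp h1.contMDiffOn fun v hv => S.mem_source (hmem v hv).1 1)
    fun v hv => (hmem v hv).2)
  refine h2.congr fun v hv => ?_
  obtain ⟨hv1, hv2⟩ := hmem v hv
  change quotientCoord hπ S' (quotientPoint π S hSN b₀ v) = _
  rw [quotientPoint_apply S hSN b₀ ⟨v, hv1⟩,
    quotientCoord_apply hπ hfib S' (x := S.point hSN ⟨v, hv1⟩) hv2]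
  rfl

/-- A quotient by orbits which is covered by slices is a real-analytic surface, and the projection
is a principal bundle. -/
theorem exists_analyticSurface_principalBundle [T2Space B] [SecondCountableTopology B]
    (hπ : Function.Surjective π) (hcont : Continuous π) (hopen : IsOpenMap π)
    (hfib : FibresAreOrbits π)
    (hcov : ∀ Γ ∈ N, ∃ S : SliceChart, S.toChart.target ⊆ N ∧ Γ ∈ S.toChart.target) :
    ∃ _ : ChartedSpace (EuclideanSpace ℝ (Fin 2)) B,
      IsAnalyticSurface B ∧ IsAnalyticPrincipalBundle N π := by
  choose S hSN hS using hcov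
  let x (b : B) : N := Function.surjInv hπ b
  let C (b : B) := quotientChart hπ hcont hopen hfib (S _ (x b).2) (hSN _ (x b).2) b
  let cs : ChartedSpace (EuclideanSpace ℝ (Fin 2)) B :=
    { atlas := Set.range C
      chartAt := C
      mem_chart_source := fun b => ⟨x b, hS _ (x b).2, Function.surjInv_eq hπ b⟩
      chart_mem_atlas := fun b => ⟨b, rfl⟩ }
  have hman : IsManifold (𝓡 2) ω B := by
    refine isManifold_of_contDiffOn _ _ _ ?_
    rintro _ _ ⟨b, rfl⟩ ⟨b', rfl⟩
    simpa using contDiffOn_transition hπ hcont hopen hfib _ _ _ _ b b'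
  refine ⟨cs, ⟨inferInstance, inferInstance, hman⟩, fun b => ?_⟩
  have hC : C b ∈ IsManifold.maximalAtlas (𝓡 2) ω B :=
    IsManifold.subset_maximalAtlas ⟨b, rfl⟩
  have hCs : ∀ u ∈ (C b).source, C b u ∈ (S _ (x b).2).base := fun u hu => (C b).map_source hu
  have hCpt : ∀ u (hu : u ∈ (C b).source),
      π ((S _ (x b).2).point (hSN _ (x b).2) ⟨C b u, hCs u hu⟩) = u := by
    intro u hu
    rw [← quotientPoint_apply (π := π) (S _ (x b).2) (hSN _ (x b).2) b]
    exact (C b).left_inv hu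
  set S₀ := S _ (x b).2 with hS₀
  -- The local trivialisation is the slice chart with its base coordinate read in the chart of the
  -- quotient.
  let e := ((C b).prod (OpenPartialHomeomorph.refl GL(2, ℝ)⁺)).trans S₀.toChart
  have hap (u g) : e (u, g) = S₀.toChart (C b u, g) := rfl
  have hsource : e.source = (C b).source ×ˢ Set.univ := by
    ext ⟨u, g⟩
    simp only [e, OpenPartialHomeomorph.trans_source, OpenPartialHomeomorph.prod_source,
      OpenPartialHomeomorph.refl_source, Set.mem_inter_iff, Set.mem_preimage]
    exact ⟨fun h => h.1, fun h => ⟨h, S₀.mem_source (hCs u h.1) g⟩⟩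
  have htarget : e.target = S₀.toChart.target := by
    ext Γ
    simp only [e, OpenPartialHomeomorph.trans_target, OpenPartialHomeomorph.prod_target,
      OpenPartialHomeomorph.refl_target, Set.mem_inter_iff, Set.mem_preimage]
    exact ⟨fun h => h.1, fun h => ⟨h, S₀.symm_fst_mem h, trivial⟩⟩
  refine ⟨(C b).source, e, (C b).open_source, mem_chart_source _ b, hsource, ?_, ?_, ?_, ?_, ?_⟩
  · rw [htarget]
    ext Γ
    constructor
    · intro h
      exact ⟨⟨Γ, hSN _ (x b).2 h⟩, ⟨⟨Γ, hSN _ (x b).2 h⟩, h, rfl⟩, rfl⟩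
    · rintro ⟨y, ⟨z, hz, he⟩, rfl⟩
      exact mem_target_of_eq hfib S₀ he hz
  · intro u hu g
    have h1 := hSN _ (x b).2 (S₀.toChart.map_source (S₀.mem_source (hCs u hu) g))
    refine ⟨h1, ?_⟩
    conv_rhs => rw [← hCpt u hu]
    rw [eq_comm, hfib]
    refine ⟨g, ?_⟩
    change act g (S₀.toChart (C b u, 1)) = S₀.toChart (C b u, g)
    rw [← S₀.equivariant _ (hCs u hu), one_mul]
  · intro u hu g h
    rw [hap, hap, S₀.equivariant _ (hCs u hu)]
  · have h1 : ContMDiffOn ((𝓡 2).prod 𝓘(ℝ, Fin 2 → Fin 2 → ℝ))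
        ((𝓡 2).prod 𝓘(ℝ, Fin 2 → Fin 2 → ℝ)) ω (Prod.map (C b) (id : GL(2, ℝ)⁺ → GL(2, ℝ)⁺))
        ((C b).source ×ˢ Set.univ) :=
      (contMDiffOn_of_mem_maximalAtlas hC).prodMap contMDiff_id.contMDiffOn
    rw [hsource]
    exact S₀.contMDiffOn.comp h1 fun p hp => S₀.mem_source (hCs p.1 hp.1) p.2
  · have h1 : ContMDiffOn ((𝓡 2).prod 𝓘(ℝ, Fin 2 → Fin 2 → ℝ))
        ((𝓡 2).prod 𝓘(ℝ, Fin 2 → Fin 2 → ℝ)) ω (Prod.map (C b).symm (id : GL(2, ℝ)⁺ → GL(2, ℝ)⁺))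
        ((C b).target ×ˢ Set.univ) :=
      (contMDiffOn_symm_of_mem_maximalAtlas hC).prodMap contMDiff_id.contMDiffOn
    rw [htarget]
    exact h1.comp S₀.contMDiffOn_symm fun Γ hΓ => ⟨S₀.symm_fst_mem hΓ, trivial⟩

end Quotient

/-! ### Topology of the moduli space -/

theorem continuous_act : Continuous fun p : GL(2, ℝ)⁺ × Z2 => act p.1 p.2 := by
  have h (i j : Fin 2) : Continuous fun T : GL(2, ℝ)⁺ => T.1.1 i j :=
    (Units.continuous_val.comp continuous_subtype_val).matrix_elem i j
  have hZ (i j k : Fin 2) : Continuous fun Γ : Z2 => Γ.1 i j k := (symbol i j k).continuous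
  refine Continuous.subtype_mk ?_ _
  refine continuous_pi fun i => continuous_pi fun j => continuous_pi fun k => ?_
  refine continuous_finsetSum _ fun a _ => continuous_finsetSum _ fun b _ =>
    continuous_finsetSum _ fun c _ => ?_
  exact ((((h a i).comp continuous_fst).mul ((h b j).comp continuous_fst)).mul
    (((h k c).comp continuous_inv).comp continuous_fst)).mul ((hZ a b c).comp continuous_snd)

theorem continuous_ricci (j k : Fin 2) : Continuous fun Γ => ricci Γ j k := by
  have hZ (i j k : Fin 2) : Continuous fun Γ : Z2 => Γ.1 i j k := (symbol i j k).continuous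
  exact continuous_finsetSum _ fun i _ => continuous_finsetSum _ fun n _ =>
    ((hZ _ _ _).mul (hZ _ _ _)).sub ((hZ _ _ _).mul (hZ _ _ _))

theorem continuous_ricciDet : Continuous ricciDet :=
  ((continuous_ricci 0 0).mul (continuous_ricci 1 1)).sub ((continuous_ricci 0 1).pow 2)

theorem act_inv_eq {g : GL(2, ℝ)⁺} {Γ Γ' : Z2} (h : act g Γ = Γ') : act g⁻¹ Γ' = Γ := by
  rw [← h, ← act_mul, mul_inv_cancel, act_one]

/-- `N` is a union of orbits on which the Ricci tensor is non-degenerate. -/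
structure IsRegular (N : Set Z2) : Prop where
  ricciDet_ne_zero : ∀ Γ ∈ N, ricciDet Γ ≠ 0
  act_mem : ∀ Γ ∈ N, ∀ g, act g Γ ∈ N

theorem isRegular_Z_one_one : IsRegular (Z 1 1) where
  ricciDet_ne_zero := fun Γ hΓ => ((mem_Z_one_one_iff Γ).1 hΓ).ne
  act_mem := fun Γ hΓ g => by
    rw [mem_Z_one_one_iff] at *
    rw [ricciDet_act]
    exact mul_neg_of_pos_of_neg (pow_pos (det_pos g) 2) hΓ

/-- For a definite form all diagonal values have one sign; completing the square shows it. Hence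
positive and negative definiteness are constant on orbits. -/
theorem ricci_mul_ricci_act_pos {Γ : Z2} (hΓ : 0 < ricciDet Γ) (g : GL(2, ℝ)⁺) :
    0 < ricci Γ 0 0 * ricci (act g Γ) 0 0 := by
  have e : ricci Γ 0 0 * ricci (act g Γ) 0 0 =
      (ricci Γ 0 0 * g.1.1 0 0 + ricci Γ 0 1 * g.1.1 1 0) ^ 2 + ricciDet Γ * g.1.1 1 0 ^ 2 := by
    simp only [ricci_act, ricciDet, Fin.sum_univ_two, ricci_one_zero]
    ring
  rw [e]
  by_cases h1 : g.1.1 1 0 = 0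
  · have h2 := det_pos g
    have h3 : g.1.1 0 0 ≠ 0 := by
      intro h3
      simp [h1, h3] at h2
    have h4 : ricci Γ 0 0 ≠ 0 := by
      intro h4
      simp only [ricciDet, h4] at hΓ
      nlinarith [sq_nonneg (ricci Γ 0 1)]
    simp only [h1, mul_zero, add_zero, ne_eq, OfNat.ofNat_ne_zero, not_false_eq_true, zero_pow]
    positivity
  · positivity

theorem isRegular_Z_zero_two : IsRegular (Z 0 2) where
  ricciDet_ne_zero := fun Γ hΓ => ((mem_Z_zero_two_iff Γ).1 hΓ).1.ne'
  act_mem := fun Γ hΓ g => by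
    rw [mem_Z_zero_two_iff] at *
    refine ⟨?_, pos_of_mul_pos_right (ricci_mul_ricci_act_pos hΓ.1 g) hΓ.2.le⟩
    rw [ricciDet_act]
    exact mul_pos (pow_pos (det_pos g) 2) hΓ.1

theorem isRegular_Z_two_zero : IsRegular (Z 2 0) where
  ricciDet_ne_zero := fun Γ hΓ => ((mem_Z_two_zero_iff Γ).1 hΓ).1.ne'
  act_mem := fun Γ hΓ g => by
    rw [mem_Z_two_zero_iff] at *
    refine ⟨?_, neg_of_mul_pos_right (ricci_mul_ricci_act_pos hΓ.1 g) hΓ.2.le⟩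
    rw [ricciDet_act]
    exact mul_pos (pow_pos (det_pos g) 2) hΓ.1

section Moduli

variable {p q : ℕ}

/-- `Quot` divides by the equivalence relation generated by local isomorphism. Each generating step
stays in one orbit, and orbits form an equivalence relation, so no further identification occurs. -/
theorem fibresAreOrbits_mk (h : IsRegular (Z p q)) :
    FibresAreOrbits (Moduli.mk : Z p q → Moduli p q) := by
  intro x y
  constructor
  · intro hxy
    have hxy' := Quot.eqvGen_exact hxy
    clear hxy
    induction hxy' with
    | rel x y hxy =>
      obtain ⟨T, hT⟩ := hxy.exists_act_eq (h.ricciDet_ne_zero _ y.2)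
      exact ⟨T⁻¹, act_inv_eq hT⟩
    | refl x => exact ⟨1, act_one _⟩
    | symm x y _ ih =>
      obtain ⟨g, hg⟩ := ih
      exact ⟨g⁻¹, act_inv_eq hg⟩
    | trans x y z _ _ ih ih' =>
      obtain ⟨g, hg⟩ := ih
      obtain ⟨g', hg'⟩ := ih'
      exact ⟨g * g', by rw [act_mul, hg, hg']⟩
  · rintro ⟨g, hg⟩
    refine (Quot.sound ?_).symm
    rw [← hg]
    exact locallyIsomorphic_act g x.1

theorem isOpenMap_mk (h : IsRegular (Z p q)) :
    IsOpenMap (Moduli.mk : Z p q → Moduli p q) := by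
  intro U hU
  rw [← isQuotientMap_quot_mk.isOpen_preimage]
  -- The saturation of U is a union of preimages of U under the group elements.
  have e : (Moduli.mk : Z p q → Moduli p q) ⁻¹' (Moduli.mk '' U) =
      ⋃ g, (fun x : Z p q => (⟨act g x.1, h.act_mem x.1 x.2 g⟩ : Z p q)) ⁻¹' U := by
    ext x
    simp only [Set.mem_preimage, Set.mem_image, Set.mem_iUnion]
    constructor
    · rintro ⟨y, hy, hyx⟩
      obtain ⟨g, hg⟩ := (fibresAreOrbits_mk h x y).1 hyx.symm
      refine ⟨g, ?_⟩
      convert! hy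
    · rintro ⟨g, hg⟩
      exact ⟨_, hg, ((fibresAreOrbits_mk h x _).2 ⟨g, rfl⟩).symm⟩
  rw [e]
  refine isOpen_iUnion fun g => hU.preimage ?_
  exact Continuous.subtype_mk (continuous_act.comp (by fun_prop :
    Continuous fun x : Z p q => (g, x.1))) _

theorem isOpenQuotientMap_mk (h : IsRegular (Z p q)) :
    IsOpenQuotientMap (Moduli.mk : Z p q → Moduli p q) :=
  ⟨Quot.mk_surjective, continuous_quot_mk, isOpenMap_mk h⟩

theorem secondCountable_moduli (h : IsRegular (Z p q)) : SecondCountableTopology (Moduli p q) :=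
  isQuotientMap_quot_mk.secondCountableTopology (isOpenMap_mk h)

theorem tendsto_act {x : ℕ → Z2} {g : ℕ → GL(2, ℝ)⁺} {k : GL(2, ℝ)⁺} {x₀ : Z2}
    (hg : Filter.Tendsto g Filter.atTop (𝓝 k)) (hx : Filter.Tendsto x Filter.atTop (𝓝 x₀)) :
    Filter.Tendsto (fun n => act (g n) (x n)) Filter.atTop (𝓝 (act k x₀)) := by
  have h := (continuous_act.tendsto (k, x₀)).comp (hg.prodMk_nhds hx)
  exact h

theorem ProperAction.exists_act_eq {N : Set Z2} (hp : ProperAction N) {x y : ℕ → Z2}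
    {x₀ y₀ : Z2} (hx : ∀ n, x n ∈ N) (hy : ∀ n, y n ∈ N) (hx₀ : x₀ ∈ N) (hy₀ : y₀ ∈ N)
    (h1 : Filter.Tendsto x Filter.atTop (𝓝 x₀)) (h2 : Filter.Tendsto y Filter.atTop (𝓝 y₀))
    (h : ∀ n, ∃ g, act g (x n) = y n) : ∃ g, act g x₀ = y₀ := by
  obtain ⟨g, hg⟩ := Classical.axiom_of_choice h
  have h3 : (fun n => act (g n) (x n)) = y := funext hg
  obtain ⟨φ, k, hφ, hk⟩ := hp x g hx (fun n => by rw [hg n]; exact hy n) x₀ hx₀ y₀ hy₀ h1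
    (by rw [h3]; exact h2)
  have h4 := tendsto_act hk (h1.comp hφ.tendsto_atTop)
  have h5 : (fun n => act (g (φ n)) ((x ∘ φ) n)) = y ∘ φ := funext fun n => hg (φ n)
  rw [h5] at h4
  exact ⟨k, tendsto_nhds_unique h4 (h2.comp hφ.tendsto_atTop)⟩

/-- Sequential closedness suffices in this metrizable setting: the connecting group elements
subconverge by properness, and their limit connects the limits. -/
theorem isClosed_orbitRelation {N : Set Z2} (hp : ProperAction N) :
    IsClosed {x : N × N | ∃ g, act g x.1.1 = x.2.1} := by
  refine IsSeqClosed.isClosed fun u x hu hx => ?_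
  have h1 : Filter.Tendsto (fun n => (u n).1.1) Filter.atTop (𝓝 x.1.1) :=
    ((continuous_subtype_val.comp continuous_fst).tendsto x).comp hx
  have h2 : Filter.Tendsto (fun n => (u n).2.1) Filter.atTop (𝓝 x.2.1) :=
    ((continuous_subtype_val.comp continuous_snd).tendsto x).comp hx
  exact hp.exists_act_eq (fun n => (u n).1.2) (fun n => (u n).2.2) x.1.2 x.2.2 h1 h2 hu

theorem t2Space_moduli (h : IsRegular (Z p q)) (hp : ProperAction (Z p q)) :
    T2Space (Moduli p q) := by
  have h1 := isClosed_orbitRelation hp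
  rw [t2Space_iff_of_isOpenQuotientMap (isOpenQuotientMap_mk h)]
  convert! h1 using 1
  ext x
  exact fibresAreOrbits_mk h x.1 x.2

end Moduli

/-! ### Properness for definite Ricci tensor -/

/-- A sequence in the group with bounded entries, relating convergent sequences of structures with
non-degenerate Ricci tensor, has a convergent subsequence. -/
theorem exists_subseq_tendsto_of_bounded {Γ : ℕ → Z2} {g : ℕ → GL(2, ℝ)⁺} {Γ₁ Γ₂ : Z2}
    (h1 : Filter.Tendsto Γ Filter.atTop (𝓝 Γ₁))
    (h2 : Filter.Tendsto (fun n => act (g n) (Γ n)) Filter.atTop (𝓝 Γ₂))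
    (hΓ₂ : ricciDet Γ₂ ≠ 0)
    (hb : ∀ i j, ∃ C, ∀ n, (g n).1.1 i j ^ 2 ≤ C) :
    ∃ (φ : ℕ → ℕ) (h : GL(2, ℝ)⁺), StrictMono φ ∧
        Filter.Tendsto (fun n => g (φ n)) Filter.atTop (𝓝 h) := by
  choose C hC using hb
  let K : Set (Fin 2 → Fin 2 → ℝ) :=
    Set.pi Set.univ fun i => Set.pi Set.univ fun j => Set.Icc (-√(C i j)) (√(C i j))
  have hK : IsCompact K := isCompact_univ_pi fun i => isCompact_univ_pi fun j => isCompact_Icc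
  obtain ⟨A, -, φ, hφ, hA⟩ := hK.tendsto_subseq (x := fun n => entries (g n)) fun n i _ j _ =>
    abs_le.1 (Real.abs_le_sqrt (hC i j n))
  have hd : Continuous fun A : Fin 2 → Fin 2 → ℝ => A 0 0 * A 1 1 - A 0 1 * A 1 0 := by fun_prop
  have hdA := (hd.tendsto A).comp hA
  -- The only danger is a limit matrix of determinant zero; the transformation law of `ricciDet`
  -- excludes it.
  have e1 : (A 0 0 * A 1 1 - A 0 1 * A 1 0) ^ 2 * ricciDet Γ₁ = ricciDet Γ₂ := by
    have t1 := (hdA.pow 2).mul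
      ((continuous_ricciDet.tendsto Γ₁).comp (h1.comp hφ.tendsto_atTop))
    have t2 := (continuous_ricciDet.tendsto Γ₂).comp (h2.comp hφ.tendsto_atTop)
    refine tendsto_nhds_unique t1 (t2.congr fun n => ?_)
    exact ricciDet_act _ _
  have hpos : 0 < A 0 0 * A 1 1 - A 0 1 * A 1 0 := by
    refine lt_of_le_of_ne (ge_of_tendsto' hdA fun n => (det_pos (g (φ n))).le) fun h0 => hΓ₂ ?_
    rw [← e1, ← h0]
    ring
  exact ⟨φ, ofEntries A hpos, hφ, isOpenEmbedding_entries.isInducing.tendsto_nhds_iff.2 hA⟩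

/-- The j-th column of g has ρ-length given by the (j, j) entry of the transformed Ricci tensor. For
definite ρ, completing the square bounds the column entries by quantities that converge along the
sequence. -/
theorem properAction_of_ricciDet_pos {N : Set Z2} (hN : ∀ Γ ∈ N, 0 < ricciDet Γ) :
    ProperAction N := by
  intro Γ g hΓ hg Γ₁ hΓ₁ Γ₂ hΓ₂ h1 h2
  refine exists_subseq_tendsto_of_bounded h1 h2 (hN _ hΓ₂).ne' fun i j => ?_
  have t (a b) := ((continuous_ricci a b).tendsto Γ₁).comp h1
  have t' (a b) := ((continuous_ricci a b).tendsto Γ₂).comp h2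
  have tD := (continuous_ricciDet.tendsto Γ₁).comp h1
  have key (a) : ∃ C, ∀ n, ricci (Γ n) a a * ricci (act (g n) (Γ n)) j j / ricciDet (Γ n) ≤ C := by
    obtain ⟨C, hC⟩ := (((t a a).mul (t' j j)).div tD (hN _ hΓ₁).ne').bddAbove_range
    exact ⟨C, fun n => hC ⟨n, rfl⟩⟩
  fin_cases i
  · obtain ⟨C, hC⟩ := key 1
    refine ⟨C, fun n => le_trans ?_ (hC n)⟩
    rw [le_div_iff₀ (hN _ (hΓ n))]
    have e : ricci (Γ n) 1 1 * ricci (act (g n) (Γ n)) j j =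
        (ricci (Γ n) 0 1 * (g n).1.1 0 j + ricci (Γ n) 1 1 * (g n).1.1 1 j) ^ 2 +
          (g n).1.1 0 j ^ 2 * ricciDet (Γ n) := by
      simp only [ricci_act, ricciDet, Fin.sum_univ_two, ricci_one_zero]
      ring
    rw [e]
    exact le_add_of_nonneg_left (sq_nonneg _)
  · obtain ⟨C, hC⟩ := key 0
    refine ⟨C, fun n => le_trans ?_ (hC n)⟩
    rw [le_div_iff₀ (hN _ (hΓ n))]
    have e : ricci (Γ n) 0 0 * ricci (act (g n) (Γ n)) j j =
        (ricci (Γ n) 0 0 * (g n).1.1 0 j + ricci (Γ n) 0 1 * (g n).1.1 1 j) ^ 2 +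
          (g n).1.1 1 j ^ 2 * ricciDet (Γ n) := by
      simp only [ricci_act, ricciDet, Fin.sum_univ_two, ricci_one_zero]
      ring
    rw [e]
    exact le_add_of_nonneg_left (sq_nonneg _)

/-! ### Conformal frames and the slice for definite Ricci tensor -/

theorem ricci_act_inv {T : GL(2, ℝ)⁺} {Γ : Z2} {M : Fin 2 → Fin 2 → ℝ}
    (h : ∀ j k, ricci Γ j k = ∑ a, ∑ b, T.1.1 a j * T.1.1 b k * M a b) (j k : Fin 2) :
    ricci (act T⁻¹ Γ) j k = M j k := by
  have hD : T.1.1 0 0 * T.1.1 1 1 - T.1.1 1 0 * T.1.1 0 1 ≠ 0 := by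
    rw [mul_comm (T.1.1 1 0)]
    exact (det_pos T).ne'
  have h1 (j k) : ∑ a, T.1.1 a j * ∑ b, T.1.1 b k * ricci (act T⁻¹ Γ) a b =
      ∑ a, T.1.1 a j * ∑ b, T.1.1 b k * M a b := by
    have h2 := ricci_act T (act T⁻¹ Γ) j k
    rw [← act_mul, inv_mul_cancel, act_one, h] at h2
    simp only [Fin.sum_univ_two] at h2 ⊢
    linear_combination -h2
  have h3 (a k) : ∑ b, T.1.1 b k * ricci (act T⁻¹ Γ) a b = ∑ b, T.1.1 b k * M a b :=
    congrFun (eq_of_sum_mul_eq (A := fun j a => T.1.1 a j)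
      (u := fun a => ∑ b, T.1.1 b k * ricci (act T⁻¹ Γ) a b)
      (v := fun a => ∑ b, T.1.1 b k * M a b) hD fun j => h1 j k) a
  exact congrFun (eq_of_sum_mul_eq (A := fun k b => T.1.1 b k)
    (u := fun b => ricci (act T⁻¹ Γ) j b) (v := fun b => M j b) hD fun k => h3 j k) k

theorem trace_act_inv {T : GL(2, ℝ)⁺} {Γ : Z2} {τ : Fin 2 → ℝ}
    (h : ∀ j, ∑ i, Γ.1 j i i = ∑ a, T.1.1 a j * τ a) (j : Fin 2) :
    ∑ i, (act T⁻¹ Γ).1 j i i = τ j := by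
  have hD : T.1.1 0 0 * T.1.1 1 1 - T.1.1 1 0 * T.1.1 0 1 ≠ 0 := by
    rw [mul_comm (T.1.1 1 0)]
    exact (det_pos T).ne'
  refine congrFun (eq_of_sum_mul_eq (A := fun j a => T.1.1 a j)
    (u := fun a => ∑ i, (act T⁻¹ Γ).1 a i i) (v := τ) hD fun j => ?_) j
  have h2 := trace_act T (act T⁻¹ Γ) j
  rw [← act_mul, inv_mul_cancel, act_one, h] at h2
  exact h2.symm

/-- The Ricci tensor is the multiple `c` of the Euclidean metric. -/
def IsConformal (Γ : Z2) (c : ℝ) : Prop := ricci Γ 0 0 = c ∧ ricci Γ 0 1 = 0 ∧ ricci Γ 1 1 = c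

/-- Together with `IsConformal.symm_right` this says that Γ, lowered by the Euclidean metric, is
totally symmetric. The Ricci equations are linear in Γ₁₁¹ − Γ₁₂² and Γ₂₂² − Γ₁₂¹ with determinant
`ricci Γ 0 1 = 0`; eliminating these differences leaves c times the wanted identity. -/
theorem IsConformal.symm_left {Γ : Z2} {c : ℝ} (h : IsConformal Γ c) (hc : c ≠ 0) :
    Γ.1 0 0 1 = Γ.1 0 1 0 := by
  obtain ⟨h0, h1, h2⟩ := h
  rw [ricci_zero_zero] at h0
  rw [ricci_zero_one] at h1
  rw [ricci_one_one] at h2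
  refine mul_left_cancel₀ hc ?_
  linear_combination Γ.1 0 1 0 * h0 - Γ.1 0 0 1 * h2 - (Γ.1 0 0 0 - Γ.1 0 1 1) * h1

theorem IsConformal.symm_right {Γ : Z2} {c : ℝ} (h : IsConformal Γ c) (hc : c ≠ 0) :
    Γ.1 0 1 1 = Γ.1 1 1 0 := by
  obtain ⟨h0, h1, h2⟩ := h
  rw [ricci_zero_zero] at h0
  rw [ricci_zero_one] at h1
  rw [ricci_one_one] at h2
  refine mul_left_cancel₀ hc ?_
  linear_combination Γ.1 1 1 0 * h0 - Γ.1 0 1 1 * h2 + (Γ.1 1 1 1 - Γ.1 0 1 0) * h1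

/-- A definite Ricci tensor is conformal in a frame with a given first covector. -/
theorem exists_isConformal {Γ : Z2} (hΓ : 0 < ricciDet Γ) {x y : ℝ} (hxy : x ≠ 0 ∨ y ≠ 0) :
    ∃ (T : GL(2, ℝ)⁺) (c : ℝ), T.1.1 0 0 = x ∧ T.1.1 0 1 = y ∧
      0 < c * ricci Γ 0 0 ∧ IsConformal (act T⁻¹ Γ) c := by
  set p := ricci Γ 0 0 with hp
  set q := ricci Γ 0 1 with hq
  set r := ricci Γ 1 1 with hr
  set D := ricciDet Γ with hD
  have hDe : D = p * r - q ^ 2 := rfl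
  have hp0 : p ≠ 0 := by
    intro h
    rw [h] at hDe
    nlinarith [sq_nonneg q]
  -- Q is `ricciDet Γ` times the squared length of the covector (x, y) for the inverse of ρ; it has
  -- the sign of ρ.
  set Q := r * x ^ 2 - 2 * q * (x * y) + p * y ^ 2 with hQ
  have hpQ : 0 < p * Q := by
    have e : p * Q = (p * y - q * x) ^ 2 + D * x ^ 2 := by
      rw [hDe]
      ring
    rw [e]
    by_cases hx : x = 0
    · have hy : y ≠ 0 := hxy.resolve_left (not_not.2 hx)
      simp only [hx, mul_zero, sub_zero, ne_eq, OfNat.ofNat_ne_zero, not_false_eq_true, zero_pow,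
        add_zero]
      positivity
    · positivity
  have hQ0 : Q ≠ 0 := fun h => by simp [h] at hpQ
  obtain ⟨s, hs, hsQ⟩ : ∃ s : ℝ, s ^ 2 = D⁻¹ ∧ 0 < s * Q := by
    have h1 : (√D)⁻¹ ^ 2 = D⁻¹ := by rw [inv_pow, Real.sq_sqrt hΓ.le]
    have h2 : 0 < (√D)⁻¹ := inv_pos.2 (Real.sqrt_pos.2 hΓ)
    rcases lt_or_gt_of_ne hQ0 with h | h
    · exact ⟨-(√D)⁻¹, by rw [neg_sq, h1], by nlinarith⟩
    · exact ⟨(√D)⁻¹, h1, by positivity⟩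
  have hsD : s ^ 2 * D = 1 := by
    rw [hs, inv_mul_cancel₀ hΓ.ne']
  -- The second row is orthogonal to the first for the inverse of ρ. The condition s² = 1/D gives
  -- both rows the same length, and the sign of s makes the determinant sQ positive.
  let T := ofEntries ![![x, y], ![s * (q * x - p * y), s * (r * x - q * y)]] (by
    simp
    linear_combination hsQ)
  have h1 (j k) : ricci Γ j k = ∑ a, ∑ b, T.1.1 a j * T.1.1 b k *
      (![![D / Q, 0], ![0, D / Q]] : Fin 2 → Fin 2 → ℝ) a b := by
    revert j k
    simp only [Fin.forall_fin_two, Fin.sum_univ_two, T, ofEntries_apply, Matrix.cons_val_zero,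
      Matrix.cons_val_one, ricci_one_zero, ← hp, ← hq, ← hr]
    refine ⟨⟨?_, ?_⟩, ?_, ?_⟩ <;> field_simp
    · linear_combination -(q * x - p * y) ^ 2 * hsD - x ^ 2 * hDe
    · linear_combination -(q * x - p * y) * (r * x - q * y) * hsD - x * y * hDe
    · linear_combination -(q * x - p * y) * (r * x - q * y) * hsD - x * y * hDe
    · linear_combination -(r * x - q * y) ^ 2 * hsD - y ^ 2 * hDe
  refine ⟨T, D / Q, rfl, rfl, ?_, ricci_act_inv h1 0 0, ricci_act_inv h1 0 1, ricci_act_inv h1 1 1⟩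
  rw [div_mul_eq_mul_div, div_pos_iff]
  rcases lt_or_gt_of_ne hQ0 with h | h
  · exact Or.inr ⟨mul_neg_of_pos_of_neg hΓ (by nlinarith), h⟩
  · exact Or.inl ⟨mul_pos hΓ (by nlinarith), h⟩

/-- A map into `𝒵(2)` given by its components. -/
def ofComponents (P : Fin 6 → EuclideanSpace ℝ (Fin 2) → ℝ) (v : EuclideanSpace ℝ (Fin 2)) : Z2 :=
  ofCoords fun i => P i v

theorem contDiff_ofComponents {P : Fin 6 → EuclideanSpace ℝ (Fin 2) → ℝ}
    (h : ∀ i, ContDiff ℝ ω (P i)) : ContDiff ℝ ω (ofComponents P) :=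
  coords.symm.contDiff.comp (contDiff_pi.2 h)

theorem fderiv_ofComponents {P : Fin 6 → EuclideanSpace ℝ (Fin 2) → ℝ}
    (h : ∀ i, ContDiff ℝ ω (P i)) (v δ : EuclideanSpace ℝ (Fin 2)) :
    fderiv ℝ (ofComponents P) v δ = ofCoords fun i => fderiv ℝ (P i) v δ := by
  have h1 : HasFDerivAt (fun v i => P i v) (ContinuousLinearMap.pi fun i => fderiv ℝ (P i) v) v :=
    hasFDerivAt_pi.2 fun i => (((h i).differentiable (by simp)) v).hasFDerivAt
  have h2 := (coords.symm.hasFDerivAt (x := fun i => P i v)).comp v h1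
  have h3 : fderiv ℝ (ofComponents P) v = _ := HasFDerivAt.fderiv h2
  rw [h3]
  rfl

theorem contDiff_coord (i : Fin 2) :
    ContDiff ℝ ω fun v : EuclideanSpace ℝ (Fin 2) => v i :=
  (EuclideanSpace.proj (𝕜 := ℝ) i).contDiff

theorem hasFDerivAt_coord (i : Fin 2) (v : EuclideanSpace ℝ (Fin 2)) :
    HasFDerivAt (fun v : EuclideanSpace ℝ (Fin 2) => v i) (EuclideanSpace.proj (𝕜 := ℝ) i) v :=
  (EuclideanSpace.proj (𝕜 := ℝ) i).hasFDerivAt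

theorem eq_one_of_entries {T : GL(2, ℝ)⁺} (h00 : T.1.1 0 0 = 1) (h01 : T.1.1 0 1 = 0)
    (h10 : T.1.1 1 0 = 0) (h11 : T.1.1 1 1 = 1) : T = 1 := by
  ext i j
  revert i j
  simp [Fin.forall_fin_two, h00, h01, h10, h11]

/-- The components of the slice of structures with conformal Ricci tensor and trace `4 e¹`. -/
def conformalComponents : Fin 6 → EuclideanSpace ℝ (Fin 2) → ℝ :=
  ![fun v => 4 - v 1, fun v => v 0, fun v => v 0, fun v => v 1, fun v => v 1, fun v => -v 0]

/-- The slice of structures with conformal Ricci tensor and trace `4 e¹`. -/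
def conformalSlice : EuclideanSpace ℝ (Fin 2) → Z2 := ofComponents conformalComponents

theorem contDiff_conformalComponents (i : Fin 6) : ContDiff ℝ ω (conformalComponents i) := by
  have h0 := contDiff_coord 0
  have h1 := contDiff_coord 1
  fin_cases i
  exacts [contDiff_const.sub h1, h0, h0, h1, h1, h0.neg]

theorem conformalSlice_apply (v : EuclideanSpace ℝ (Fin 2)) :
    conformalSlice v = ofCoords ![4 - v 1, v 0, v 0, v 1, v 1, -v 0] := by
  apply Z2.ext_coords <;> rfl

theorem fderiv_conformalSlice (v δ : EuclideanSpace ℝ (Fin 2)) :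
    fderiv ℝ conformalSlice v δ = ofCoords ![-δ 1, δ 0, δ 0, δ 1, δ 1, -δ 0] := by
  rw [conformalSlice, fderiv_ofComponents contDiff_conformalComponents]
  congr 1
  ext i
  have h0 := hasFDerivAt_coord 0 v
  have h1 := hasFDerivAt_coord 1 v
  fin_cases i
  · exact congrArg (fun L => L δ) (h1.const_sub 4).fderiv
  · exact congrArg (fun L => L δ) h0.fderiv
  · exact congrArg (fun L => L δ) h0.fderiv
  · exact congrArg (fun L => L δ) h1.fderiv
  · exact congrArg (fun L => L δ) h1.fderiv
  · exact congrArg (fun L => L δ) h0.neg.fderiv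

/-- The conformal factor of the Ricci tensor on the slice. -/
def conformalFactor (v : EuclideanSpace ℝ (Fin 2)) : ℝ := v 1 * (4 - 2 * v 1) - 2 * v 0 ^ 2

/-- The factor equals 2(1 − v₀² − (v₁ − 1)²). So the positive definite structures correspond to the
open unit disc about (0, 1), and the negative definite ones with non-zero trace to the exterior of
its closure. -/
theorem isConformal_conformalSlice (v : EuclideanSpace ℝ (Fin 2)) :
    IsConformal (conformalSlice v) (conformalFactor v) := by
  refine ⟨?_, ?_, ?_⟩ <;>
    simp [ricci_zero_zero, ricci_zero_one, ricci_one_one, conformalSlice_apply, ofCoords,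
      conformalFactor] <;> ring

/-- The linearised form of `conformalSlice_injective`: preserving the trace 4e¹ kills the first row
of Y, and preserving the conformal shape kills the second. -/
theorem infinitesimallyTransverse_conformalSlice {v : EuclideanSpace ℝ (Fin 2)}
    (hv : conformalFactor v ≠ 0) : InfinitesimallyTransverse conformalSlice v := by
  intro δ Y h
  have e000 := h 0 0 0
  have e001 := h 0 0 1
  have e010 := h 0 1 0
  have e011 := h 0 1 1
  have e110 := h 1 1 0
  have e111 := h 1 1 1
  simp [fderiv_conformalSlice, conformalSlice_apply, ofCoords, Fin.sum_univ_two] at *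
  have y00 : Y 0 0 = 0 := by linarith
  have y01 : Y 0 1 = 0 := by linarith
  simp only [y00, y01] at e000 e001 e010 e011 e110 e111
  have hne : v 1 ^ 2 - 2 * v 1 + v 0 ^ 2 ≠ 0 := by
    contrapose! hv
    rw [conformalFactor]
    linear_combination -2 * hv
  have y10 : Y 1 0 = 0 := by
    refine (mul_eq_zero.1 (?_ : (v 1 ^ 2 - 2 * v 1 + v 0 ^ 2) * Y 1 0 = 0)).resolve_left hne
    grind
  have y11 : Y 1 1 = 0 := by
    refine (mul_eq_zero.1 (?_ : (v 1 ^ 2 - 2 * v 1 + v 0 ^ 2) * Y 1 1 = 0)).resolve_left hne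
    grind
  simp only [y10, y11] at e000 e010
  constructor
  · ext i
    fin_cases i
    · simpa using e010
    · simpa using e000
  · ext i j
    fin_cases i <;> fin_cases j
    exacts [y00, y01, y10, y11]

/-- Equality of traces fixes the first row of T to be (1, 0). Conformality makes the second row
orthogonal to it and of equal length, and positivity of the determinant settles the sign. -/
theorem conformalSlice_injective {v w : EuclideanSpace ℝ (Fin 2)} (hv : conformalFactor v ≠ 0)
    {T : GL(2, ℝ)⁺} (h : act T (conformalSlice v) = conformalSlice w) : T = 1 ∧ v = w := by
  have t0 := trace_act T (conformalSlice v) 0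
  have t1 := trace_act T (conformalSlice v) 1
  have r00 := ricci_act T (conformalSlice v) 0 0
  have r01 := ricci_act T (conformalSlice v) 0 1
  have r11 := ricci_act T (conformalSlice v) 1 1
  obtain ⟨a0, a1, a2⟩ := isConformal_conformalSlice v
  obtain ⟨b0, b1, b2⟩ := isConformal_conformalSlice w
  simp only [h, Fin.sum_univ_two, ricci_one_zero, a0, a1, a2, b0, b1, b2] at r00 r01 r11
  simp only [h] at t0 t1
  simp [conformalSlice_apply, ofCoords] at t0 t1
  have hd := det_pos T
  have h00 : T.1.1 0 0 = 1 := by linarith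
  simp only [h00, t1] at r00 r01 r11 hd
  have hd' : 0 < T.1.1 1 1 := by linarith
  have h10 : T.1.1 1 0 = 0 := by
    have : conformalFactor v * (T.1.1 1 1 * T.1.1 1 0) = 0 := by linarith
    simpa [hv, hd'.ne'] using this
  have h11 : T.1.1 1 1 = 1 := by
    have h2 : conformalFactor v * (T.1.1 1 1 ^ 2) = conformalFactor v * 1 := by
      rw [h10] at r00
      linarith
    have h3 := mul_left_cancel₀ hv h2
    nlinarith
  obtain rfl := eq_one_of_entries h00 t1 h10 h11
  refine ⟨rfl, ?_⟩
  rw [act_one, conformalSlice_apply, conformalSlice_apply] at h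
  ext i
  fin_cases i
  · exact congrArg (fun Γ : Z2 => Γ.1 0 0 1) h
  · exact congrArg (fun Γ : Z2 => Γ.1 0 1 1) h

theorem eq_conformalSlice {Γ : Z2} {c : ℝ} (hc : c ≠ 0) (h : IsConformal Γ c)
    (h0 : ∑ i, Γ.1 0 i i = 4) (h1 : ∑ i, Γ.1 1 i i = 0) :
    Γ = conformalSlice !₂[Γ.1 0 1 0, Γ.1 0 1 1] := by
  have s1 := h.symm_left hc
  have s2 := h.symm_right hc
  have s3 := Γ.2 1 0 0
  simp only [Fin.sum_univ_two] at h0 h1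
  apply Z2.ext_coords <;> simp [conformalSlice_apply, ofCoords] <;> linarith

/-- A structure with definite Ricci tensor and non-zero trace can be moved to the slice. -/
theorem exists_act_conformalSlice {Γ : Z2} (hΓ : 0 < ricciDet Γ)
    (hτ : ∑ i, Γ.1 0 i i ≠ 0 ∨ ∑ i, Γ.1 1 i i ≠ 0) :
    ∃ T v, act T (conformalSlice v) = Γ ∧ 0 < conformalFactor v * ricci Γ 0 0 := by
  obtain ⟨T, c, hx, hy, hc, hT⟩ := exists_isConformal hΓ
    (x := (∑ i, Γ.1 0 i i) / 4) (y := (∑ i, Γ.1 1 i i) / 4)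
    (by simpa only [ne_eq, div_eq_zero_iff, OfNat.ofNat_ne_zero, or_false] using hτ)
  have hc0 : c ≠ 0 := by
    rintro rfl
    simp at hc
  have htr := trace_act_inv (T := T) (Γ := Γ) (τ := ![4, 0]) (by
    rw [Fin.forall_fin_two]
    rw [Fin.sum_univ_two (f := fun a => T.1.1 a 0 * _), Fin.sum_univ_two (f := fun a => T.1.1 a 1 * _),
      hx, hy]
    simp)
  have h1 := eq_conformalSlice hc0 hT (htr 0) (htr 1)
  refine ⟨T, _, by rw [← h1, ← act_mul, inv_mul_cancel, act_one], ?_⟩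
  have h2 := isConformal_conformalSlice !₂[(act T⁻¹ Γ).1 0 1 0, (act T⁻¹ Γ).1 0 1 1]
  rw [← h1] at h2
  rwa [← h2.1, hT.1]

/-! ### Trace-free structures: the orbit of Γ₂ and its isotropy -/

theorem ext_entries {S T : GL(2, ℝ)⁺} (h : ∀ i j, S.1.1 i j = T.1.1 i j) : S = T :=
  isOpenEmbedding_entries.injective (funext fun i => funext fun j => h i j)

/-- A trace-free symmetric cubic is harmonic and has two parameters; its conformal factor is minus a
sum of squares. Hence a positive definite Ricci tensor forces a non-zero trace. -/
theorem eq_of_isConformal_of_trace_eq_zero {Γ : Z2} {c : ℝ} (hc : c ≠ 0) (h : IsConformal Γ c)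
    (h0 : ∑ i, Γ.1 0 i i = 0) (h1 : ∑ i, Γ.1 1 i i = 0) :
    Γ = ofCoords ![-Γ.1 0 1 1, Γ.1 0 1 0, Γ.1 0 1 0, Γ.1 0 1 1, Γ.1 0 1 1, -Γ.1 0 1 0] ∧
      c = -2 * (Γ.1 0 1 0 ^ 2 + Γ.1 0 1 1 ^ 2) := by
  have s1 := h.symm_left hc
  have s2 := h.symm_right hc
  have s3 := Γ.2 1 0 0
  simp only [Fin.sum_univ_two] at h0 h1
  constructor
  · apply Z2.ext_coords <;> simp [ofCoords] <;> linarith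
  · rw [← h.1, ricci_zero_zero, s1]
    have e1 : Γ.1 0 0 0 = -Γ.1 0 1 1 := by linarith
    have e2 : Γ.1 1 1 1 = -Γ.1 0 1 0 := by linarith
    rw [e1, e2]
    ring

theorem Gamma2_eq : Gamma2 = ofCoords ![1 / √2, 0, 0, -(1 / √2), -(1 / √2), 0] := by
  apply Z2.ext_coords <;> rfl

/-- The trace-free structures in conformal position are rotations of multiples of `Γ₂`. -/
theorem exists_act_Gamma2 {c d : ℝ} (h : c ≠ 0 ∨ d ≠ 0) :
    ∃ T, act T Gamma2 = ofCoords ![-d, c, c, d, d, -c] := by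
  have h2 : (√2 : ℝ) ≠ 0 := by positivity
  -- With d + ic as complex parameter of the harmonic cubic, a rotation multiplies it by the cube of
  -- the unit complex number, and a dilation by its ratio. Since Γ₂ has parameter −1/√2,
  -- multiplication by |u|²u, of modulus |u|³ and argument that of u, must satisfy u³ = −√2(d + ic).
  obtain ⟨u, hu⟩ := IsAlgClosed.exists_pow_nat_eq (⟨-d * √2, -c * √2⟩ : ℂ) (n := 3) (by norm_num)
  have hre := congrArg Complex.re hu
  have him := congrArg Complex.im hu
  simp only [pow_succ, pow_zero, one_mul, Complex.mul_re, Complex.mul_im] at hre him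
  set p := u.re
  set q := u.im
  have hpos : 0 < p ^ 2 + q ^ 2 := by
    by_contra! hle
    have hp : p = 0 := by nlinarith [sq_nonneg p, sq_nonneg q]
    have hq : q = 0 := by nlinarith [sq_nonneg p, sq_nonneg q]
    simp [hp, hq] at hre him
    tauto
  have hd : d = -(p ^ 3 - 3 * p * q ^ 2) / √2 := by
    field_simp
    linear_combination hre
  have hc : c = -(3 * p ^ 2 * q - q ^ 3) / √2 := by
    field_simp
    linear_combination him
  let T := ofEntries ![![(p ^ 2 + q ^ 2) * p, -((p ^ 2 + q ^ 2) * q)],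
    ![(p ^ 2 + q ^ 2) * q, (p ^ 2 + q ^ 2) * p]] (by
      have : 0 < (p ^ 2 + q ^ 2) ^ 3 := by positivity
      simp
      linear_combination this)
  refine ⟨T, act_eq_of_sum_mul T ?_⟩
  rw [hd, hc, Gamma2_eq]
  simp only [Fin.forall_fin_two, Fin.sum_univ_two, T, ofEntries_apply]
  simp [ofCoords]
  refine ⟨⟨⟨?_, ?_⟩, ?_, ?_⟩, ⟨?_, ?_⟩, ?_, ?_⟩ <;> field_simp <;> ring

theorem ricci_neg_of_trace_eq_zero {Γ : Z2} (hΓ : 0 < ricciDet Γ)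
    (h0 : ∑ i, Γ.1 0 i i = 0) (h1 : ∑ i, Γ.1 1 i i = 0) :
    ricci Γ 0 0 < 0 ∧ Γ ∈ orbit Gamma2 := by
  obtain ⟨T, c, -, -, hc, hT⟩ := exists_isConformal hΓ (x := 1) (y := 0) (Or.inl one_ne_zero)
  have hc0 : c ≠ 0 := by
    rintro rfl
    simp at hc
  have htr := trace_act_inv (T := T) (Γ := Γ) (τ := 0) (by
    rw [Fin.forall_fin_two, h0, h1]
    simp)
  obtain ⟨e1, e2⟩ := eq_of_isConformal_of_trace_eq_zero hc0 hT (htr 0) (htr 1)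
  set x := (act T⁻¹ Γ).1 0 1 0
  set y := (act T⁻¹ Γ).1 0 1 1
  have hcneg : c < 0 := lt_of_le_of_ne (by rw [e2]; nlinarith [sq_nonneg x, sq_nonneg y]) hc0
  refine ⟨neg_of_mul_pos_right hc hcneg.le, ?_⟩
  obtain ⟨S, hS⟩ := exists_act_Gamma2 (c := x) (d := y) (by
    by_contra! h
    rw [h.1, h.2] at e2
    simp at e2
    exact hc0 e2)
  rw [← e1] at hS
  refine ⟨S * T, ?_⟩
  change act (S * T) Gamma2 = Γ
  rw [act_mul, hS, ← act_mul, inv_mul_cancel, act_one]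

/-- The rotation with cosine `x` and sine `y`. -/
def rotation (x y : ℝ) (h : x ^ 2 + y ^ 2 = 1) : GL(2, ℝ)⁺ :=
  ofEntries ![![x, -y], ![y, x]] (by
    simp
    linear_combination zero_lt_one.trans_eq h.symm)

/-- For z = x + iy the two conditions say that z equals the square of its conjugate; on the unit
circle this is z³ = 1. -/
theorem rotation_mem_isotropy {x y : ℝ} (h : x ^ 2 + y ^ 2 = 1) (hx : x = x ^ 2 - y ^ 2)
    (hy : y = -2 * x * y) : rotation x y h ∈ isotropy Gamma2 := by
  refine act_eq_of_sum_mul _ ?_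
  rw [Gamma2_eq]
  simp only [Fin.forall_fin_two, Fin.sum_univ_two, rotation, ofEntries_apply]
  simp [ofCoords]
  refine ⟨⟨⟨?_, ?_⟩, ?_, ?_⟩, ⟨?_, ?_⟩, ?_, ?_⟩
  · linear_combination (√2)⁻¹ * hx
  · linear_combination (√2)⁻¹ * hy
  · linear_combination (√2)⁻¹ * hy
  · linear_combination -(√2)⁻¹ * hx
  · linear_combination (√2)⁻¹ * hy
  · linear_combination -(√2)⁻¹ * hx
  · linear_combination -(√2)⁻¹ * hx
  · linear_combination -(√2)⁻¹ * hy

theorem exists_rotation_of_mem_isotropy {T : GL(2, ℝ)⁺} (hT : T ∈ isotropy Gamma2) :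
    ∃ (x y : ℝ) (h : x ^ 2 + y ^ 2 = 1), T = rotation x y h ∧ x = x ^ 2 - y ^ 2 ∧
      y = -2 * x * y := by
  have hT : act T Gamma2 = Gamma2 := hT
  have r (j k) : ricci Gamma2 j k = (Matrix.diagonal fun _ => -1 : Matrix (Fin 2) (Fin 2) ℝ) j k := by
    rw [← symRicci_apply, symRicci_Gamma2]
  have r00 := ricci_act T Gamma2 0 0
  have r01 := ricci_act T Gamma2 0 1
  have r11 := ricci_act T Gamma2 1 1
  simp [hT, r, Fin.sum_univ_two] at r00 r01 r11
  have hd := det_pos T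
  set x := T.1.1 0 0
  set y := T.1.1 1 0
  set z := T.1.1 0 1 with hz
  set w := T.1.1 1 1 with hw
  have hxy : x ^ 2 + y ^ 2 = 1 := by linarith
  -- T preserves the Ricci tensor of Γ₂, which is minus the Euclidean metric, so T is orthogonal;
  -- its positive determinant makes it a rotation.
  have hd1 : x * w - z * y = 1 := by
    have : (x * w - z * y) ^ 2 = 1 := by
      linear_combination (w ^ 2 + z ^ 2) * r00 + r11 - (x * z + y * w) * r01
    nlinarith
  have hwx : w = x := by linear_combination x * hd1 - w * hxy + y * r01
  have hzy : z = -y := by linear_combination -y * hd1 - z * hxy + x * r01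
  have s0 := sum_mul_act T Gamma2 0 0 0
  have s1 := sum_mul_act T Gamma2 0 0 1
  have h2 : (√2 : ℝ)⁻¹ ≠ 0 := by positivity
  rw [hT, Gamma2_eq] at s0 s1
  simp only [Fin.sum_univ_two] at s0 s1
  simp [ofCoords] at s0 s1
  refine ⟨x, y, hxy, ext_entries ?_, mul_left_cancel₀ h2 ?_, mul_left_cancel₀ h2 ?_⟩
  · simp only [Fin.forall_fin_two, rotation, ofEntries_apply]
    simp [← hz, ← hw, hwx, hzy, x, y]
  · linear_combination s0
  · linear_combination s1

theorem rotation_injective {x y x' y' : ℝ} {h : x ^ 2 + y ^ 2 = 1} {h' : x' ^ 2 + y' ^ 2 = 1}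
    (e : rotation x y h = rotation x' y' h') : x = x' ∧ y = y' :=
  ⟨congrArg (fun T : GL(2, ℝ)⁺ => T.1.1 0 0) e, congrArg (fun T : GL(2, ℝ)⁺ => T.1.1 1 0) e⟩

theorem sqrt_three_div_two_sq : (√3 / 2 : ℝ) ^ 2 = 3 / 4 := by
  rw [div_pow, Real.sq_sqrt (by norm_num)]
  norm_num

theorem card_isotropy_Gamma2 : Nat.card (isotropy Gamma2) = 3 := by
  have h3 := sqrt_three_div_two_sq
  have hs : (√3 / 2 : ℝ) ≠ 0 := by positivity
  have e : (isotropy Gamma2 : Set GL(2, ℝ)⁺) = {rotation 1 0 (by norm_num),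
      rotation (-1 / 2) (√3 / 2) (by rw [h3]; norm_num),
      rotation (-1 / 2) (-(√3 / 2)) (by rw [neg_sq, h3]; norm_num)} := by
    ext T
    simp only [SetLike.mem_coe, Set.mem_insert_iff, Set.mem_singleton_iff]
    constructor
    · intro hT
      obtain ⟨x, y, h, rfl, hx, hy⟩ := exists_rotation_of_mem_isotropy hT
      have h1 : y * (1 + 2 * x) = 0 := by linear_combination hy
      rcases mul_eq_zero.1 h1 with h0 | h0
      · subst h0
        have : x = 1 := by nlinarith
        subst this
        exact Or.inl rfl
      · have hx' : x = -1 / 2 := by linarith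
        subst hx'
        have h4 : (y - √3 / 2) * (y + √3 / 2) = 0 := by linear_combination h - h3
        rcases mul_eq_zero.1 h4 with h5 | h5
        · obtain rfl : y = √3 / 2 := by linarith
          exact Or.inr (Or.inl rfl)
        · obtain rfl : y = -(√3 / 2) := by linarith
          exact Or.inr (Or.inr rfl)
    · rintro (rfl | rfl | rfl)
      · exact rotation_mem_isotropy _ (by norm_num) (by norm_num)
      · exact rotation_mem_isotropy _ (by rw [h3]; norm_num) (by ring)
      · exact rotation_mem_isotropy _ (by rw [neg_sq, h3]; norm_num) (by ring)
  have hc : Nat.card (isotropy Gamma2) = (isotropy Gamma2 : Set GL(2, ℝ)⁺).ncard := rfl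
  rw [hc, e, Set.ncard_eq_three]
  refine ⟨_, _, _, fun h => ?_, fun h => ?_, fun h => ?_, rfl⟩
  · have := (rotation_injective h).1
    norm_num at this
  · have := (rotation_injective h).1
    norm_num at this
  · have := (rotation_injective h).2
    apply hs
    linarith

/-- The conjugation is by g⁻¹ because the action is from the right. -/
theorem isotropy_act (g : GL(2, ℝ)⁺) (Γ : Z2) :
    isotropy (act g Γ) = (isotropy Γ).map (MulAut.conj g⁻¹).toMonoidHom := by
  ext T
  have h1 : T ∈ isotropy (act g Γ) ↔ g * T * g⁻¹ ∈ isotropy Γ := by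
    change act T (act g Γ) = act g Γ ↔ act (g * T * g⁻¹) Γ = Γ
    rw [act_mul, act_mul]
    exact ⟨fun h => by rw [h, ← act_mul, mul_inv_cancel, act_one],
      fun h => by conv_rhs => rw [← h, ← act_mul, inv_mul_cancel, act_one]⟩
  rw [h1, Subgroup.mem_map]
  constructor
  · exact fun h => ⟨_, h, by simp [mul_assoc]⟩
  · rintro ⟨S, hS, rfl⟩
    simpa [mul_assoc] using hS

theorem card_isotropy_of_mem_orbit {Γ : Z2} (h : Γ ∈ orbit Gamma2) : Nat.card (isotropy Γ) = 3 := by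
  obtain ⟨g, rfl⟩ := h
  change Nat.card (isotropy (act g Gamma2)) = 3
  rw [isotropy_act, Subgroup.card_map_of_injective (MulAut.conj g⁻¹).injective,
    card_isotropy_Gamma2]

theorem isotropy_ne_bot_of_mem_orbit {Γ : Z2} (h : Γ ∈ orbit Gamma2) : isotropy Γ ≠ ⊥ := by
  intro h0
  have := card_isotropy_of_mem_orbit h
  rw [h0, Subgroup.card_bot] at this
  norm_num at this

/-! ### Global slice charts for definite Ricci tensor -/

theorem exists_conformalSliceChart {V : Set (EuclideanSpace ℝ (Fin 2))} (hV : IsOpen V)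
    (h : ∀ v ∈ V, conformalFactor v ≠ 0) :
    ∃ S : SliceChart, S.base = V ∧ ∀ v g, S.toChart (v, g) = act g (conformalSlice v) :=
  exists_sliceChart (contDiff_ofComponents contDiff_conformalComponents) hV
    (fun v hv => infinitesimallyTransverse_conformalSlice (h v hv))
    fun v hv _ _ _ he => conformalSlice_injective (h v hv) he

theorem SliceChart.mem_target_iff {S : SliceChart} {s : EuclideanSpace ℝ (Fin 2) → Z2}
    (hS : ∀ v g, S.toChart (v, g) = act g (s v)) {Γ : Z2} :
    Γ ∈ S.toChart.target ↔ ∃ v ∈ S.base, ∃ g, act g (s v) = Γ := by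
  constructor
  · intro h
    refine ⟨_, S.symm_fst_mem h, (S.toChart.symm Γ).2, ?_⟩
    rw [← hS, Prod.mk.eta, S.toChart.right_inv h]
  · rintro ⟨v, hv, g, rfl⟩
    rw [← hS]
    exact S.toChart.map_source (S.mem_source hv g)

theorem continuous_conformalFactor : Continuous conformalFactor := by
  have h0 := (contDiff_coord 0).continuous
  have h1 := (contDiff_coord 1).continuous
  unfold conformalFactor
  fun_prop

theorem ricciDet_conformalSlice (v : EuclideanSpace ℝ (Fin 2)) :
    ricciDet (conformalSlice v) = conformalFactor v ^ 2 := by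
  obtain ⟨h0, h1, h2⟩ := isConformal_conformalSlice v
  rw [ricciDet, h0, h1, h2]
  ring

/-- A single slice covers the structures with positive definite Ricci tensor. -/
theorem exists_sliceChart_Z_zero_two : ∃ S : SliceChart, S.toChart.target = Z 0 2 := by
  obtain ⟨S, hb, hS⟩ := exists_conformalSliceChart (V := {v | 0 < conformalFactor v})
    (isOpen_lt continuous_const continuous_conformalFactor) fun v hv => ne_of_gt hv
  refine ⟨S, Set.ext fun Γ => ?_⟩
  rw [SliceChart.mem_target_iff hS, hb]
  constructor
  · rintro ⟨v, hv, g, rfl⟩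
    refine isRegular_Z_zero_two.act_mem _ ((mem_Z_zero_two_iff _).2 ⟨?_, ?_⟩) g
    · rw [ricciDet_conformalSlice]
      exact pow_pos hv 2
    · rw [(isConformal_conformalSlice v).1]
      exact hv
  · intro hΓ
    rw [mem_Z_zero_two_iff] at hΓ
    obtain ⟨T, v, he, hv⟩ := exists_act_conformalSlice hΓ.1 (by
      by_contra! h
      exact absurd (ricci_neg_of_trace_eq_zero hΓ.1 h.1 h.2).1 hΓ.2.not_gt)
    exact ⟨v, pos_of_mul_pos_left hv hΓ.2.le, T, he⟩

/-- A single slice covers the structures with negative definite Ricci tensor, except for the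
orbit of `Γ₂`. -/
theorem exists_sliceChart_Z_two_zero :
    ∃ S : SliceChart, S.toChart.target = Z 2 0 \ orbit Gamma2 := by
  obtain ⟨S, hb, hS⟩ := exists_conformalSliceChart (V := {v | conformalFactor v < 0})
    (isOpen_lt continuous_conformalFactor continuous_const) fun v hv => ne_of_lt hv
  refine ⟨S, Set.ext fun Γ => ?_⟩
  constructor
  · intro h
    -- The chart cannot reach the orbit of Γ₂: the action is free on its target, while the isotropy
    -- on that orbit has order three.
    refine ⟨?_, fun h' => isotropy_ne_bot_of_mem_orbit h' (S.isotropy_eq_bot h)⟩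
    rw [SliceChart.mem_target_iff hS, hb] at h
    obtain ⟨v, hv, g, rfl⟩ := h
    refine isRegular_Z_two_zero.act_mem _ ((mem_Z_two_zero_iff _).2 ⟨?_, ?_⟩) g
    · rw [ricciDet_conformalSlice]
      exact sq_pos_of_neg hv
    · rw [(isConformal_conformalSlice v).1]
      exact hv
  · rintro ⟨hΓ, hne⟩
    rw [mem_Z_two_zero_iff] at hΓ
    rw [SliceChart.mem_target_iff hS, hb]
    obtain ⟨T, v, he, hv⟩ := exists_act_conformalSlice hΓ.1 (by
      by_contra! h
      exact hne (ricci_neg_of_trace_eq_zero hΓ.1 h.1 h.2).2)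
    exact ⟨v, neg_of_mul_pos_left hv hΓ.2.le, T, he⟩

/-! ### Null frames and slices for indefinite Ricci tensor -/

/-- The Ricci tensor is `2 e¹ e²`. -/
def IsNull (Γ : Z2) : Prop := ricci Γ 0 0 = 0 ∧ ricci Γ 0 1 = 1 ∧ ricci Γ 1 1 = 0

/-- The two diagonal equations are a homogeneous linear system for Γ₁₁¹ − Γ₁₂² and Γ₂₂² − Γ₁₂¹ whose
determinant is, up to sign, `ricci Γ 0 1 = 1`. So null structures form the quadric cd − be = 1 in
four-space. -/
theorem IsNull.eq {Γ : Z2} (h : IsNull Γ) :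
    Γ = ofCoords ![Γ.1 0 1 1, Γ.1 0 0 1, Γ.1 0 1 0, Γ.1 0 1 1, Γ.1 1 1 0, Γ.1 0 1 0] ∧
      Γ.1 0 1 0 * Γ.1 0 1 1 - Γ.1 0 0 1 * Γ.1 1 1 0 = 1 := by
  obtain ⟨h0, h1, h2⟩ := h
  rw [ricci_zero_zero] at h0
  rw [ricci_zero_one] at h1
  rw [ricci_one_one] at h2
  refine ⟨?_, h1⟩
  apply Z2.ext_coords <;> try rfl
  · change Γ.1 0 0 0 = Γ.1 0 1 1
    linear_combination Γ.1 0 1 0 * h0 - Γ.1 0 0 1 * h2 - (Γ.1 0 0 0 - Γ.1 0 1 1) * h1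
  · change Γ.1 1 1 1 = Γ.1 0 1 0
    linear_combination Γ.1 0 1 1 * h2 - Γ.1 1 1 0 * h0 - (Γ.1 1 1 1 - Γ.1 0 1 0) * h1

theorem isNull_ofCoords {b c d e : ℝ} (h : c * d - b * e = 1) :
    IsNull (ofCoords ![d, b, c, d, e, c]) := by
  refine ⟨?_, ?_, ?_⟩ <;> simp [ricci_zero_zero, ricci_zero_one, ricci_one_one, ofCoords, h]

theorem IsNull.ricciDet_eq {Γ : Z2} (h : IsNull Γ) : ricciDet Γ = -1 := by
  rw [ricciDet, h.1, h.2.1, h.2.2]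
  norm_num

/-- An indefinite Ricci tensor can be brought to null form. -/
theorem exists_isNull {Γ : Z2} (hΓ : ricciDet Γ < 0) : ∃ T, IsNull (act T⁻¹ Γ) := by
  -- The rows of A are linear forms whose product is half of the quadratic form; positivity of the
  -- determinant fixes their order.
  suffices h : ∃ A : Fin 2 → Fin 2 → ℝ, 0 < A 0 0 * A 1 1 - A 0 1 * A 1 0 ∧
      ricci Γ 0 0 = 2 * (A 0 0 * A 1 0) ∧ ricci Γ 0 1 = A 0 0 * A 1 1 + A 0 1 * A 1 0 ∧
      ricci Γ 1 1 = 2 * (A 0 1 * A 1 1) by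
    obtain ⟨A, hA, h00, h01, h11⟩ := h
    have h1 (j k) : ricci Γ j k = ∑ a, ∑ b, (ofEntries A hA).1.1 a j * (ofEntries A hA).1.1 b k *
        (![![0, 1], ![1, 0]] : Fin 2 → Fin 2 → ℝ) a b := by
      revert j k
      simp [Fin.forall_fin_two, Fin.sum_univ_two, ofEntries_apply, h00, h01, h11, ricci_one_zero]
      refine ⟨⟨?_, ?_⟩, ?_, ?_⟩ <;> ring
    exact ⟨ofEntries A hA, ricci_act_inv h1 0 0, ricci_act_inv h1 0 1, ricci_act_inv h1 1 1⟩
  have hD : ricciDet Γ = ricci Γ 0 0 * ricci Γ 1 1 - ricci Γ 0 1 ^ 2 := rfl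
  set p := ricci Γ 0 0
  set q := ricci Γ 0 1
  set r := ricci Γ 1 1
  by_cases hp : p = 0
  · have hq : q ≠ 0 := by
      intro hq
      simp [hp, hq] at hD
      linarith
    rcases lt_or_gt_of_ne hq with h | h
    · exact ⟨![![0, 1], ![q, r / 2]], by simpa using h, by simp [hp], by simp, by simp; ring⟩
    · exact ⟨![![q, r / 2], ![0, 1]], by simpa using h, by simp [hp], by simp, by simp; ring⟩
  · have hm : √(-ricciDet Γ) ^ 2 = -ricciDet Γ := Real.sq_sqrt (by linarith)
    have hm0 : 0 < √(-ricciDet Γ) := Real.sqrt_pos.2 (by linarith)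
    set m := √(-ricciDet Γ)
    -- This is the factorisation px² + 2qxy + ry² = p⁻¹(px + (q − m)y)(px + (q + m)y) with m² = q² −
    -- pr; the determinant is m.
    refine ⟨![![1 / 2, (q - m) / (2 * p)], ![p, q + m]], ?_, ?_, ?_, ?_⟩ <;> simp <;> field_simp
    · linarith
    · ring
    · linear_combination hm - hD

/-- T preserves e¹e², so it fixes or exchanges the two null lines; an exchange would have negative
determinant. What remains is diag(t, 1/t), acting on (b, c, d, e) with weights 3, −1, 1, −3. -/
theorem IsNull.act_eq {Γ Γ' : Z2} (h : IsNull Γ) (h' : IsNull Γ') {T : GL(2, ℝ)⁺}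
    (hT : act T Γ = Γ') : T.1.1 0 1 = 0 ∧ T.1.1 1 0 = 0 ∧ T.1.1 0 0 * T.1.1 1 1 = 1 ∧
      T.1.1 1 1 * Γ'.1 0 0 1 = T.1.1 0 0 ^ 2 * Γ.1 0 0 1 ∧
      Γ'.1 0 1 0 = T.1.1 1 1 * Γ.1 0 1 0 ∧
      T.1.1 0 0 * Γ'.1 1 1 0 = T.1.1 1 1 ^ 2 * Γ.1 1 1 0 ∧
      Γ'.1 0 1 1 = T.1.1 0 0 * Γ.1 0 1 1 := by
  have r00 := ricci_act T Γ 0 0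
  have r01 := ricci_act T Γ 0 1
  have r11 := ricci_act T Γ 1 1
  have hd := det_pos T
  simp only [hT, Fin.sum_univ_two, ricci_one_zero, h.1, h.2.1, h.2.2, h'.1, h'.2.1, h'.2.2]
    at r00 r01 r11
  have h00 : T.1.1 0 0 ≠ 0 := by
    intro h0
    simp only [h0] at r01 hd
    linarith
  have h10 : T.1.1 1 0 = 0 := by
    have : T.1.1 0 0 * T.1.1 1 0 = 0 := by linarith
    simpa [h00] using this
  simp only [h10] at r00 r01 r11
  have hm : T.1.1 0 0 * T.1.1 1 1 = 1 := by linarith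
  have h11 : T.1.1 1 1 ≠ 0 := right_ne_zero_of_mul_eq_one hm
  have h01 : T.1.1 0 1 = 0 := by
    have : T.1.1 1 1 * T.1.1 0 1 = 0 := by linarith
    simpa [h11] using this
  have s001 := sum_mul_act T Γ 0 0 1
  have s010 := sum_mul_act T Γ 0 1 0
  have s011 := sum_mul_act T Γ 0 1 1
  have s110 := sum_mul_act T Γ 1 1 0
  simp only [hT, Fin.sum_univ_two, h10, h01] at s001 s010 s011 s110
  refine ⟨h01, h10, hm, by linarith, mul_left_cancel₀ h00 ?_, by linarith,
    mul_left_cancel₀ h11 ?_⟩ <;> linarith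

/-- The linearisation of `IsNull.act_eq`. The hypothesis `h'` is tangency to the quadric and
excludes dilations, leaving only multiples of diag(1, −1). -/
theorem infinitesimal_action_null {b c d e β γ δ ε : ℝ} (h : c * d - b * e = 1)
    (h' : γ * d + c * δ - (β * e + b * ε) = 0) {Y : Fin 2 → Fin 2 → ℝ}
    (hY : ∀ i j l, (ofCoords ![δ, β, γ, δ, ε, γ]).1 i j l +
      ∑ a, Y a i * (ofCoords ![d, b, c, d, e, c]).1 a j l +
      ∑ a, Y a j * (ofCoords ![d, b, c, d, e, c]).1 i a l =
      ∑ m, Y l m * (ofCoords ![d, b, c, d, e, c]).1 i j m) :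
    Y 0 1 = 0 ∧ Y 1 0 = 0 ∧ Y 1 1 = -Y 0 0 ∧ β = -3 * Y 0 0 * b ∧ γ = Y 0 0 * c ∧
      ε = 3 * Y 0 0 * e ∧ δ = -Y 0 0 * d := by
  have e000 := hY 0 0 0
  have e001 := hY 0 0 1
  have e010 := hY 0 1 0
  have e011 := hY 0 1 1
  have e110 := hY 1 1 0
  have e111 := hY 1 1 1
  simp [ofCoords, Fin.sum_univ_two] at e000 e001 e010 e011 e110 e111
  have y10 : Y 1 0 = 0 := by
    linear_combination (d * (e000 - e011) + b * (e111 - e010)) / 2 - Y 1 0 * h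
  have y01 : Y 0 1 = 0 := by
    linear_combination (c * (e111 - e010) + e * (e000 - e011)) / 2 - Y 0 1 * h
  have y11 : Y 1 1 = -Y 0 0 := by
    linear_combination d * e010 + c * e011 - b * e110 - e * e001 - h' - (Y 0 0 + Y 1 1) * h
  simp only [y10, y01, y11] at e001 e010 e011 e110
  exact ⟨y01, y10, y11, by linarith, by linarith, by linarith, by linarith⟩

/-- A surface of structures whose Ricci tensor is in null form; `P` gives the symbols
`Γ_{11}^2`, `Γ_{12}^1`, `Γ_{22}^1`, `Γ_{12}^2`. -/
def nullSlice (P : Fin 4 → EuclideanSpace ℝ (Fin 2) → ℝ) : EuclideanSpace ℝ (Fin 2) → Z2 :=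
  ofComponents ![P 3, P 0, P 1, P 3, P 2, P 1]

theorem nullSlice_apply (P : Fin 4 → EuclideanSpace ℝ (Fin 2) → ℝ)
    (v : EuclideanSpace ℝ (Fin 2)) :
    nullSlice P v = ofCoords ![P 3 v, P 0 v, P 1 v, P 3 v, P 2 v, P 1 v] := by
  apply Z2.ext_coords <;> rfl

/-- Reduces the slice conditions for the whole group to those for the one-parameter group diag(t,
1/t) on the quadric: `htrans` is the infinitesimal condition and `hinj` the global one. -/
theorem exists_nullSliceChart {P : Fin 4 → EuclideanSpace ℝ (Fin 2) → ℝ}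
    (hP : ∀ i, ContDiff ℝ ω (P i)) (hdet : ∀ v, P 1 v * P 3 v - P 0 v * P 2 v = 1)
    (htrans : ∀ v δ y, fderiv ℝ (P 0) v δ = -3 * y * P 0 v → fderiv ℝ (P 1) v δ = y * P 1 v →
      fderiv ℝ (P 2) v δ = 3 * y * P 2 v → fderiv ℝ (P 3) v δ = -y * P 3 v → y = 0 ∧ δ = 0)
    (hinj : ∀ v w t u, t * u = 1 → u * P 0 w = t ^ 2 * P 0 v → P 1 w = u * P 1 v →
      t * P 2 w = u ^ 2 * P 2 v → P 3 w = t * P 3 v → t = 1 ∧ v = w) :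
    ∃ S : SliceChart, S.base = Set.univ ∧ ∀ v g, S.toChart (v, g) = act g (nullSlice P v) := by
  have hC : ∀ i, ContDiff ℝ ω
      ((![P 3, P 0, P 1, P 3, P 2, P 1] : Fin 6 → EuclideanSpace ℝ (Fin 2) → ℝ) i) := by
    intro i
    fin_cases i
    exacts [hP 3, hP 0, hP 1, hP 3, hP 2, hP 1]
  have hnull (v) : IsNull (nullSlice P v) := by
    rw [nullSlice_apply]
    exact isNull_ofCoords (hdet v)
  refine exists_sliceChart (contDiff_ofComponents hC) isOpen_univ (fun v _ δ Y hY => ?_)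
    fun v _ w _ g hg => ?_
  · have hd (i) : HasFDerivAt (P i) (fderiv ℝ (P i) v) v :=
      ((hP i).differentiable (by simp) v).hasFDerivAt
    have h1 := ((hd 1).mul (hd 3)).sub ((hd 0).mul (hd 2))
    have h2 : (P 1 * P 3 - P 0 * P 2) = fun _ => 1 := funext hdet
    rw [h2] at h1
    have h3 := congrArg (fun L : EuclideanSpace ℝ (Fin 2) →L[ℝ] ℝ => L δ)
      (h1.unique (hasFDerivAt_const _ _))
    simp at h3
    have h4 : fderiv ℝ (ofComponents ![P 3, P 0, P 1, P 3, P 2, P 1]) v δ =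
        ofCoords ![fderiv ℝ (P 3) v δ, fderiv ℝ (P 0) v δ, fderiv ℝ (P 1) v δ,
          fderiv ℝ (P 3) v δ, fderiv ℝ (P 2) v δ, fderiv ℝ (P 1) v δ] := by
      rw [fderiv_ofComponents hC]
      apply Z2.ext_coords <;> rfl
    rw [h4] at hY
    change ∀ i j l, _ + ∑ a, Y a i * (nullSlice P v).1 a j l +
      ∑ a, Y a j * (nullSlice P v).1 i a l = ∑ m, Y l m * (nullSlice P v).1 i j m at hY
    rw [nullSlice_apply] at hY
    obtain ⟨y01, y10, y11, k0, k1, k2, k3⟩ := infinitesimal_action_null (hdet v)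
      (by linear_combination h3) hY
    obtain ⟨hy, hδ⟩ := htrans v δ _ k0 k1 k2 k3
    refine ⟨hδ, ?_⟩
    ext i j
    fin_cases i <;> fin_cases j
    exacts [hy, y01, y10, by simpa [hy] using y11]
  · obtain ⟨h01, h10, hm, k0, k1, k2, k3⟩ := (hnull v).act_eq (hnull w) hg
    simp only [nullSlice_apply] at k0 k1 k2 k3
    obtain ⟨ht, hvw⟩ := hinj v w _ _ hm k0 k1 k2 k3
    rw [ht, one_mul] at hm
    exact ⟨eq_one_of_entries ht h01 h10 hm, hvw⟩

/-- Rescaling the null directions. -/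
theorem exists_act_null {b c d e t u : ℝ} (h : t * u = 1) :
    ∃ T, act T (ofCoords ![u * d, u ^ 3 * b, t * c, u * d, t ^ 3 * e, t * c]) =
      ofCoords ![d, b, c, d, e, c] := by
  refine ⟨ofEntries ![![t, 0], ![0, u]] (by simp [h]), act_eq_of_sum_mul _ ?_⟩
  simp only [Fin.forall_fin_two, Fin.sum_univ_two, ofEntries_apply]
  simp [ofCoords]
  refine ⟨⟨⟨?_, ?_⟩, ?_, ?_⟩, ⟨?_, ?_⟩, ?_, ?_⟩ <;> grind

theorem exists_cube_eq (b : ℝ) : ∃ t : ℝ, t ^ 3 = b := by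
  rcases le_total 0 b with hb | hb
  · exact ⟨_, Real.rpow_inv_natCast_pow hb three_ne_zero⟩
  · refine ⟨-((-b) ^ ((3 : ℕ) : ℝ)⁻¹), ?_⟩
    rw [Odd.neg_pow (by decide), Real.rpow_inv_natCast_pow (neg_nonneg.2 hb) three_ne_zero, neg_neg]

/-- On the quadric, (b, c, d) is never zero. One of these coordinates is normalised to 1 by diag(t,
1/t), and the equation cd − be = 1 is solved for a further one. The weights 3, −1, 1 are odd, so the
normalisation leaves no residual t = −1. -/
theorem exists_sliceChart_of_isNull {Γ : Z2} (h : IsNull Γ) :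
    ∃ S : SliceChart, Γ ∈ S.toChart.target ∧
      ∀ v ∈ S.base, IsNull (S.toChart (v, 1)) := by
  obtain ⟨hΓ, hdet⟩ := h.eq
  set b := Γ.1 0 0 1
  set c := Γ.1 0 1 0
  set d := Γ.1 0 1 1
  set e := Γ.1 1 1 0
  have key (P : Fin 4 → EuclideanSpace ℝ (Fin 2) → ℝ)
      (hP : ∀ v, P 1 v * P 3 v - P 0 v * P 2 v = 1)
      (hS : ∃ S : SliceChart, S.base = Set.univ ∧
        ∀ v g, S.toChart (v, g) = act g (nullSlice P v))
      (t u : ℝ) (htu : t * u = 1) (v) (h0 : P 0 v = u ^ 3 * b) (h1 : P 1 v = t * c)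
      (h2 : P 2 v = t ^ 3 * e) (h3 : P 3 v = u * d) :
      ∃ S : SliceChart, Γ ∈ S.toChart.target ∧
        ∀ v ∈ S.base, IsNull (S.toChart (v, 1)) := by
    obtain ⟨S, hb, hS⟩ := hS
    refine ⟨S, ?_, fun v _ => ?_⟩
    · rw [SliceChart.mem_target_iff hS, hb]
      obtain ⟨T, hT⟩ := exists_act_null (b := b) (c := c) (d := d) (e := e) htu
      refine ⟨v, trivial, T, ?_⟩
      rw [nullSlice_apply, h0, h1, h2, h3, hT, ← hΓ]
    · rw [hS, act_one, nullSlice_apply]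
      exact isNull_ofCoords (hP v)
  have f0 := hasFDerivAt_coord 0
  have f1 := hasFDerivAt_coord 1
  have c0 := contDiff_coord 0
  have c1 := contDiff_coord 1
  by_cases hd : d = 0
  swap
  -- The surface d = 1, with parameters b and e, so that c = 1 + be; it is reached with t = d.
  · refine key ![fun v => v 0, fun v => 1 + v 0 * v 1, fun v => v 1, fun _ => 1] ?_ ?_
      d d⁻¹ (mul_inv_cancel₀ hd) !₂[d⁻¹ ^ 3 * b, d ^ 3 * e] ?_ ?_ ?_ ?_
    · intro v
      simp
    · refine exists_nullSliceChart ?_ ?_ ?_ ?_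
      · intro i
        fin_cases i
        exacts [c0, contDiff_const.add (c0.mul c1), c1, contDiff_const]
      · intro v
        simp
      · intro v δ y k0 k1 k2 k3
        simp [(f0 v).fderiv, (f1 v).fderiv] at k0 k2 k3
        subst k3
        refine ⟨rfl, ?_⟩
        ext i
        fin_cases i
        · simpa using k0
        · simpa using k2
      · intro v w t u htu k0 k1 k2 k3
        simp at k0 k2 k3
        subst k3
        refine ⟨rfl, ?_⟩
        ext i
        fin_cases i <;> simp <;> grind
    all_goals simp
    · field_simp
      linear_combination -hdet
    · field_simp
  by_cases hc : c = 0
  swap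
  -- The surface c = 1, with d = 1 + be; it is reached with t = 1/c.
  · refine key ![fun v => v 0, fun _ => 1, fun v => v 1, fun v => 1 + v 0 * v 1] ?_ ?_
      c⁻¹ c (inv_mul_cancel₀ hc) !₂[c ^ 3 * b, c⁻¹ ^ 3 * e] ?_ ?_ ?_ ?_
    · intro v
      simp
    · refine exists_nullSliceChart ?_ ?_ ?_ ?_
      · intro i
        fin_cases i
        exacts [c0, contDiff_const, c1, contDiff_const.add (c0.mul c1)]
      · intro v
        simp
      · intro v δ y k0 k1 k2 k3
        simp [(f0 v).fderiv, (f1 v).fderiv] at k0 k1 k2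
        subst k1
        refine ⟨rfl, ?_⟩
        ext i
        fin_cases i
        · simpa using k0
        · simpa using k2
      · intro v w t u htu k0 k1 k2 k3
        simp at k0 k1 k2
        subst k1
        rw [mul_one] at htu
        subst htu
        refine ⟨rfl, ?_⟩
        ext i
        fin_cases i <;> simp <;> grind
    all_goals simp
    · field_simp
    · field_simp
      linear_combination -hdet
  · have hb : b ≠ 0 := by
      intro hb
      rw [hb, hc, hd] at hdet
      norm_num at hdet
    obtain ⟨t, ht⟩ := exists_cube_eq b
    have ht0 : t ≠ 0 := by
      rintro rfl
      apply hb
      rw [← ht]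
      norm_num
    -- The surface b = 1, with parameters c and d, so that e = cd − 1. Since b has weight 3, it is
    -- reached with the real cube root of b, whose uniqueness gives injectivity.
    refine key ![fun _ => 1, fun v => v 0, fun v => v 0 * v 1 - 1, fun v => v 1] ?_ ?_
      t t⁻¹ (mul_inv_cancel₀ ht0) !₂[t * c, t⁻¹ * d] ?_ ?_ ?_ ?_
    · intro v
      simp
    · refine exists_nullSliceChart ?_ ?_ ?_ ?_
      · intro i
        fin_cases i
        exacts [contDiff_const, c0, (c0.mul c1).sub contDiff_const, c1]
      · intro v
        simp
      · intro v δ y k0 k1 k2 k3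
        simp [(f0 v).fderiv, (f1 v).fderiv] at k0 k1 k3
        subst k0
        refine ⟨rfl, ?_⟩
        ext i
        fin_cases i
        · simpa using k1
        · simpa using k3
      · intro v w t u htu k0 k1 k2 k3
        simp at k0 k1 k3
        have h3 : t ^ 3 = 1 ^ 3 := by
          rw [k0] at htu
          linear_combination htu
        have h1 : t = 1 := (Odd.strictMono_pow (by decide : Odd 3)).injective h3
        subst h1
        rw [one_mul] at htu
        subst htu
        refine ⟨rfl, ?_⟩
        ext i
        fin_cases i <;> simp <;> grind
    all_goals simp
    · rw [← ht]
      field_simp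
    · field_simp
      linear_combination hdet - e * ht

theorem SliceChart.target_subset_Z_one_one {S : SliceChart}
    (hS : ∀ v ∈ S.base, IsNull (S.toChart (v, 1))) : S.toChart.target ⊆ Z 1 1 := by
  intro Γ hΓ
  have hv := S.symm_fst_mem hΓ
  have h1 : S.toChart ((S.toChart.symm Γ).1, 1) ∈ Z 1 1 := by
    rw [mem_Z_one_one_iff, (hS _ hv).ricciDet_eq]
    norm_num
  have h2 := isRegular_Z_one_one.act_mem _ h1 (S.toChart.symm Γ).2
  rwa [← S.equivariant _ hv, one_mul, Prod.mk.eta, S.toChart.right_inv hΓ] at h2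

theorem exists_sliceChart_Z_one_one {Γ : Z2} (hΓ : Γ ∈ Z 1 1) :
    ∃ S : SliceChart, Γ ∈ S.toChart.target ∧ ∀ v ∈ S.base, IsNull (S.toChart (v, 1)) := by
  obtain ⟨T, hT⟩ := exists_isNull ((mem_Z_one_one_iff Γ).1 hΓ)
  obtain ⟨S, hS, hS'⟩ := exists_sliceChart_of_isNull hT
  refine ⟨S, ?_, hS'⟩
  have := S.act_mem_target hS T
  rwa [← act_mul, inv_mul_cancel, act_one] at this

/-! ### Properness for indefinite Ricci tensor -/

/-- Here d scales by t and b by t³, so for |t| ≥ 1 the sum d² + b² grows at least by the factor t².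
The summand 1 covers |t| ≤ 1. Exchanging the roles of t and u bounds 1/t through c and e. -/
theorem sq_le_of_weights {b d b' d' t u : ℝ} (htu : t * u = 1) (hb : u * b' = t ^ 2 * b)
    (hd : d' = t * d) (h : 0 < d ^ 2 + b ^ 2) :
    t ^ 2 ≤ 1 + (d' ^ 2 + b' ^ 2) / (d ^ 2 + b ^ 2) := by
  have hb' : b' = t ^ 3 * b := by linear_combination t * hb - b' * htu
  rcases le_total (t ^ 2) 1 with h1 | h1
  · exact h1.trans (le_add_of_nonneg_right (by positivity))
  · refine le_add_of_nonneg_of_le zero_le_one ?_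
    rw [le_div_iff₀ h, hd, hb']
    have h2 : t ^ 2 * 1 ≤ t ^ 2 * (t ^ 2 * t ^ 2) :=
      mul_le_mul_of_nonneg_left (one_le_mul_of_one_le_of_one_le h1 h1) (sq_nonneg t)
    nlinarith [mul_le_mul_of_nonneg_right h2 (sq_nonneg b)]

theorem exists_subseq_of_isNull {Γ : ℕ → Z2} {g : ℕ → GL(2, ℝ)⁺} {Γ₁ Γ₂ : Z2}
    (hΓ : ∀ n, IsNull (Γ n)) (hg : ∀ n, IsNull (act (g n) (Γ n)))
    (hΓ₁ : IsNull Γ₁) (hΓ₂ : IsNull Γ₂)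
    (h1 : Filter.Tendsto Γ Filter.atTop (𝓝 Γ₁))
    (h2 : Filter.Tendsto (fun n => act (g n) (Γ n)) Filter.atTop (𝓝 Γ₂)) :
    ∃ (φ : ℕ → ℕ) (h : GL(2, ℝ)⁺), StrictMono φ ∧
        Filter.Tendsto (fun n => g (φ n)) Filter.atTop (𝓝 h) := by
  -- By cd − be = 1 neither (d, b) nor (c, e) can vanish, so the ratios in the bound converge.
  have hpos {Γ : Z2} (h : IsNull Γ) : 0 < Γ.1 0 1 1 ^ 2 + Γ.1 0 0 1 ^ 2 ∧
      0 < Γ.1 0 1 0 ^ 2 + Γ.1 1 1 0 ^ 2 := by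
    have h0 := h.eq.2
    constructor
    · by_contra! hle
      have e1 : Γ.1 0 1 1 = 0 := by nlinarith [sq_nonneg (Γ.1 0 1 1), sq_nonneg (Γ.1 0 0 1)]
      have e2 : Γ.1 0 0 1 = 0 := by nlinarith [sq_nonneg (Γ.1 0 1 1), sq_nonneg (Γ.1 0 0 1)]
      simp [e1, e2] at h0
    · by_contra! hle
      have e1 : Γ.1 0 1 0 = 0 := by nlinarith [sq_nonneg (Γ.1 0 1 0), sq_nonneg (Γ.1 1 1 0)]
      have e2 : Γ.1 1 1 0 = 0 := by nlinarith [sq_nonneg (Γ.1 0 1 0), sq_nonneg (Γ.1 1 1 0)]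
      simp [e1, e2] at h0
  have t1 (i j k) := ((symbol i j k).continuous.tendsto Γ₁).comp h1
  have t2 (i j k) := ((symbol i j k).continuous.tendsto Γ₂).comp h2
  have hbdd (i j k i' j' k' : Fin 2) (h0 : Γ₁.1 i j k ^ 2 + Γ₁.1 i' j' k' ^ 2 ≠ 0) :
      ∃ C, ∀ n, 1 + ((act (g n) (Γ n)).1 i j k ^ 2 + (act (g n) (Γ n)).1 i' j' k' ^ 2) /
        ((Γ n).1 i j k ^ 2 + (Γ n).1 i' j' k' ^ 2) ≤ C := by
    obtain ⟨C, hC⟩ := (((((t2 i j k).pow 2).add ((t2 i' j' k').pow 2)).div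
      (((t1 i j k).pow 2).add ((t1 i' j' k').pow 2)) h0).const_add 1).bddAbove_range
    exact ⟨C, fun n => hC ⟨n, rfl⟩⟩
  have hact (n) := (hΓ n).act_eq (hg n) rfl
  refine exists_subseq_tendsto_of_bounded h1 h2 (by rw [hΓ₂.ricciDet_eq]; norm_num) ?_
  simp only [Fin.forall_fin_two]
  refine ⟨⟨?_, 0, fun n => by simp [(hact n).1]⟩, ⟨0, fun n => by simp [(hact n).2.1]⟩, ?_⟩
  · obtain ⟨C, hC⟩ := hbdd 0 1 1 0 0 1 (hpos hΓ₁).1.ne'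
    refine ⟨C, fun n => le_trans ?_ (hC n)⟩
    obtain ⟨-, -, hm, k0, k1, k2, k3⟩ := hact n
    exact sq_le_of_weights hm k0 k3 (hpos (hΓ n)).1
  · obtain ⟨C, hC⟩ := hbdd 0 1 0 1 1 0 (hpos hΓ₁).2.ne'
    refine ⟨C, fun n => le_trans ?_ (hC n)⟩
    obtain ⟨-, -, hm, k0, k1, k2, k3⟩ := hact n
    exact sq_le_of_weights ((mul_comm _ _).trans hm) k2 k1 (hpos (hΓ n)).2

theorem SliceChart.tendsto_symm (S : SliceChart) {Γ : ℕ → Z2} {Γ₁ : Z2}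
    (hΓ₁ : Γ₁ ∈ S.toChart.target) (h : Filter.Tendsto Γ Filter.atTop (𝓝 Γ₁)) :
    Filter.Tendsto (fun n => (S.toChart.symm (Γ n)).2) Filter.atTop (𝓝 (S.toChart.symm Γ₁).2) ∧
    Filter.Tendsto (fun n => S.toChart ((S.toChart.symm (Γ n)).1, 1)) Filter.atTop
      (𝓝 (S.toChart ((S.toChart.symm Γ₁).1, 1))) := by
  have h1 := (S.toChart.continuousAt_symm hΓ₁).tendsto.comp h
  refine ⟨(continuous_snd.tendsto _).comp h1, ?_⟩
  have h2 := (S.toChart.continuousAt (S.mem_source (S.symm_fst_mem hΓ₁) 1)).tendsto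
  exact h2.comp (((continuous_fst.tendsto _).comp h1).prodMk_nhds tendsto_const_nhds)

/-- Slice charts around the two limits write both sequences as convergent group elements applied to
convergent null structures. This reduces the claim to `exists_subseq_of_isNull`. -/
theorem properAction_Z_one_one : ProperAction (Z 1 1) := by
  intro Γ g hΓ hg Γ₁ hΓ₁ Γ₂ hΓ₂ h1 h2
  obtain ⟨S, hS, hSn⟩ := exists_sliceChart_Z_one_one hΓ₁
  obtain ⟨S', hS', hSn'⟩ := exists_sliceChart_Z_one_one hΓ₂
  obtain ⟨m, hm⟩ := Filter.eventually_atTop.1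
    ((h1.eventually (S.toChart.open_target.mem_nhds hS)).and
      (h2.eventually (S'.toChart.open_target.mem_nhds hS')))
  have hm1 (n) : Γ (n + m) ∈ S.toChart.target := (hm (n + m) (Nat.le_add_left m n)).1
  have hm2 (n) : act (g (n + m)) (Γ (n + m)) ∈ S'.toChart.target :=
    (hm (n + m) (Nat.le_add_left m n)).2
  obtain ⟨a1, a2⟩ := S.tendsto_symm hS (h1.comp (Filter.tendsto_add_atTop_nat m))
  obtain ⟨b1, b2⟩ := S'.tendsto_symm hS' (h2.comp (Filter.tendsto_add_atTop_nat m))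
  simp only [Function.comp_apply] at a1 a2 b1 b2
  set x : ℕ → GL(2, ℝ)⁺ := fun n => (S.toChart.symm (Γ (n + m))).2
  set y : ℕ → GL(2, ℝ)⁺ := fun n => (S'.toChart.symm (act (g (n + m)) (Γ (n + m)))).2
  set X : ℕ → Z2 := fun n => S.toChart ((S.toChart.symm (Γ (n + m))).1, 1)
  have hX (n) : act (x n) (X n) = Γ (n + m) := by
    rw [← S.equivariant _ (S.symm_fst_mem (hm1 n)), one_mul, Prod.mk.eta,
      S.toChart.right_inv (hm1 n)]
  have hY (n) : act (x n * g (n + m) * (y n)⁻¹) (X n) =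
      S'.toChart ((S'.toChart.symm (act (g (n + m)) (Γ (n + m)))).1, 1) := by
    rw [act_mul, act_mul, hX]
    refine act_inv_eq ?_
    rw [← S'.equivariant _ (S'.symm_fst_mem (hm2 n)), one_mul, Prod.mk.eta,
      S'.toChart.right_inv (hm2 n)]
  obtain ⟨φ, h, hφ, hh⟩ := exists_subseq_of_isNull (Γ := X)
    (g := fun n => x n * g (n + m) * (y n)⁻¹) (fun n => hSn _ (S.symm_fst_mem (hm1 n)))
    (fun n => by rw [hY]; exact hSn' _ (S'.symm_fst_mem (hm2 n)))
    (hSn _ (S.symm_fst_mem hS)) (hSn' _ (S'.symm_fst_mem hS')) a2 (by simpa only [hY] using b2)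
  -- The original elements are recovered as g = x⁻¹(x g y⁻¹)y; the index is shifted by m because the
  -- charts contain the sequences only from m on.
  have hlim := ((a1.comp hφ.tendsto_atTop).inv.mul hh).mul (b1.comp hφ.tendsto_atTop)
  refine ⟨fun n => φ n + m, _, hφ.add_const m, hlim.congr fun n => ?_⟩
  simp only [Function.comp_apply]
  group

/-! ### Assembly -/

theorem fixedPointFree_of_sliceCharts {N : Set Z2}
    (h : ∀ Γ ∈ N, ∃ S : SliceChart, S.toChart.target ⊆ N ∧ Γ ∈ S.toChart.target) :
    FixedPointFree N := by
  intro Γ hΓ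
  obtain ⟨S, -, hS⟩ := h Γ hΓ
  exact S.isotropy_eq_bot hS

theorem exists_bundle_moduli {p q : ℕ} (h : IsRegular (Z p q)) (hp : ProperAction (Z p q))
    (hcov : ∀ Γ ∈ Z p q, ∃ S : SliceChart, S.toChart.target ⊆ Z p q ∧ Γ ∈ S.toChart.target) :
    ∃ _ : ChartedSpace (EuclideanSpace ℝ (Fin 2)) (Moduli p q),
      IsAnalyticSurface (Moduli p q) ∧
      IsAnalyticPrincipalBundle (Z p q) (Moduli.mk : Z p q → Moduli p q) :=
  have := t2Space_moduli h hp
  have := secondCountable_moduli h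
  exists_analyticSurface_principalBundle Quot.mk_surjective continuous_quot_mk (isOpenMap_mk h)
    (fibresAreOrbits_mk h) hcov

theorem properAction_Z_two_zero : ProperAction (Z 2 0) :=
  properAction_of_ricciDet_pos fun Γ hΓ => ((mem_Z_two_zero_iff Γ).1 hΓ).1

theorem isotropy_ne_bot_iff {Γ : Z2} (hΓ : Γ ∈ Z 2 0) :
    isotropy Γ ≠ ⊥ ↔ Γ ∈ orbit Gamma2 := by
  refine ⟨fun h => ?_, isotropy_ne_bot_of_mem_orbit⟩
  by_contra hne
  obtain ⟨S, hS⟩ := exists_sliceChart_Z_two_zero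
  exact h (S.isotropy_eq_bot (hS ▸ ⟨hΓ, hne⟩))

theorem mk_ne_exceptionalPoint_iff (Γ : Z 2 0) :
    (Moduli.mk Γ : Moduli 2 0) ≠ exceptionalPoint ↔ Γ.1 ∉ orbit Gamma2 := by
  rw [not_iff_not, eq_comm]
  exact fibresAreOrbits_mk isRegular_Z_two_zero _ _

/-- The projection away from the exceptional orbit. -/
def regularProjection (Γ : ↥(Z 2 0 \ orbit Gamma2)) : {b : Moduli 2 0 // b ≠ exceptionalPoint} :=
  ⟨Moduli.mk ⟨Γ.1, Γ.2.1⟩, (mk_ne_exceptionalPoint_iff _).2 Γ.2.2⟩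

theorem continuous_regularProjection : Continuous regularProjection :=
  Continuous.subtype_mk (continuous_quot_mk.comp (by fun_prop)) _

theorem isOpenMap_regularProjection : IsOpenMap regularProjection := by
  obtain ⟨S, hS⟩ := exists_sliceChart_Z_two_zero
  -- The complement of the exceptional orbit is open as the target of a chart, so openness is
  -- inherited from the projection of 𝒵(2,0).
  have hO : IsOpen (Z 2 0 \ orbit Gamma2) := hS ▸ S.toChart.open_target
  intro U hU
  obtain ⟨W, hW, rfl⟩ := isOpen_induced_iff.1 hU
  have h1 : IsOpen ((Subtype.val : Z 2 0 → Z2) ⁻¹' (W ∩ (Z 2 0 \ orbit Gamma2))) :=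
    (hW.inter hO).preimage continuous_subtype_val
  have h2 := (isOpenMap_mk isRegular_Z_two_zero _ h1).preimage
    (continuous_subtype_val (p := fun b : Moduli 2 0 => b ≠ exceptionalPoint))
  convert! h2 using 1
  ext b
  constructor
  · rintro ⟨x, hx, rfl⟩
    exact ⟨⟨x.1, x.2.1⟩, ⟨hx, x.2⟩, rfl⟩
  · rintro ⟨x, ⟨hx, hx'⟩, he⟩
    exact ⟨⟨x.1, hx'⟩, hx, Subtype.ext he⟩

theorem surjective_regularProjection : Function.Surjective regularProjection := by
  rintro ⟨b, hb⟩
  induction b using Quot.ind with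
  | mk x => exact ⟨⟨x.1, x.2, (mk_ne_exceptionalPoint_iff x).1 hb⟩, rfl⟩

theorem fibresAreOrbits_regularProjection : FibresAreOrbits regularProjection := fun x y =>
  Subtype.ext_iff.trans
    (fibresAreOrbits_mk isRegular_Z_two_zero ⟨x.1, x.2.1⟩ ⟨y.1, y.2.1⟩)

theorem exists_bundle_regularProjection :
    ∃ _ : ChartedSpace (EuclideanSpace ℝ (Fin 2)) {b : Moduli 2 0 // b ≠ exceptionalPoint},
      IsAnalyticSurface {b : Moduli 2 0 // b ≠ exceptionalPoint} ∧
      IsAnalyticPrincipalBundle (Z 2 0 \ orbit Gamma2) regularProjection := by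
  have := t2Space_moduli isRegular_Z_two_zero properAction_Z_two_zero
  have := secondCountable_moduli isRegular_Z_two_zero
  have : SecondCountableTopology {b : Moduli 2 0 // b ≠ exceptionalPoint} :=
    Topology.IsInducing.subtypeVal.secondCountableTopology
  obtain ⟨S, hS⟩ := exists_sliceChart_Z_two_zero
  exact exists_analyticSurface_principalBundle surjective_regularProjection
    continuous_regularProjection isOpenMap_regularProjection fibresAreOrbits_regularProjection
    fun Γ hΓ => ⟨S, hS.le, hS ▸ hΓ⟩

end TypeA

end

theorem theorem1p11 :
    (∀ p q : ℕ, (p, q) = (1, 1) ∨ (p, q) = (0, 2) →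
      TypeA.FixedPointFree (TypeA.Z p q) ∧
      TypeA.ProperAction (TypeA.Z p q) ∧
      ∃ _ : ChartedSpace (EuclideanSpace ℝ (Fin 2)) (TypeA.Moduli p q),
        TypeA.IsAnalyticSurface (TypeA.Moduli p q) ∧
        TypeA.IsAnalyticPrincipalBundle (TypeA.Z p q)
          (TypeA.Moduli.mk : TypeA.Z p q → TypeA.Moduli p q)) ∧
    (∀ Γ ∈ TypeA.Z 2 0, TypeA.isotropy Γ ≠ ⊥ →
      Nonempty (TypeA.isotropy Γ ≃* Multiplicative (ZMod 3)) ∧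
      TypeA.LocallyIsomorphic Γ TypeA.Gamma2) ∧
    (∀ Γ ∈ TypeA.Z 2 0, TypeA.isotropy Γ ≠ ⊥ ↔ Γ ∈ TypeA.orbit TypeA.Gamma2) ∧
    TypeA.ProperAction (TypeA.Z 2 0) ∧
    ∃ (_ : ChartedSpace (EuclideanSpace ℝ (Fin 2))
          {b : TypeA.Moduli 2 0 // b ≠ TypeA.exceptionalPoint})
      (π : ↥(TypeA.Z 2 0 \ TypeA.orbit TypeA.Gamma2) →
          {b : TypeA.Moduli 2 0 // b ≠ TypeA.exceptionalPoint}),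
        (∀ Γ, (π Γ).1 = TypeA.Moduli.mk ⟨Γ.1, Γ.2.1⟩) ∧
        TypeA.IsAnalyticSurface {b : TypeA.Moduli 2 0 // b ≠ TypeA.exceptionalPoint} ∧
        TypeA.IsAnalyticPrincipalBundle (TypeA.Z 2 0 \ TypeA.orbit TypeA.Gamma2) π := by
  open TypeA in
  refine ⟨?_, ?_, fun Γ hΓ => isotropy_ne_bot_iff hΓ, properAction_Z_two_zero, ?_⟩
  · intro p q h
    obtain h | h := h <;> obtain ⟨rfl, rfl⟩ := Prod.mk.inj h
    · have hcov : ∀ Γ ∈ Z 1 1, ∃ S : SliceChart,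
          S.toChart.target ⊆ Z 1 1 ∧ Γ ∈ S.toChart.target := fun Γ hΓ => by
        obtain ⟨S, hS, hS'⟩ := exists_sliceChart_Z_one_one hΓ
        exact ⟨S, SliceChart.target_subset_Z_one_one hS', hS⟩
      exact ⟨fixedPointFree_of_sliceCharts hcov, properAction_Z_one_one,
        exists_bundle_moduli isRegular_Z_one_one properAction_Z_one_one hcov⟩
    · have hcov : ∀ Γ ∈ Z 0 2, ∃ S : SliceChart,
          S.toChart.target ⊆ Z 0 2 ∧ Γ ∈ S.toChart.target := fun Γ hΓ => by
        obtain ⟨S, hS⟩ := exists_sliceChart_Z_zero_two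
        exact ⟨S, hS.le, hS ▸ hΓ⟩
      have hp : ProperAction (Z 0 2) :=
        properAction_of_ricciDet_pos fun Γ hΓ => ((mem_Z_zero_two_iff Γ).1 hΓ).1
      exact ⟨fixedPointFree_of_sliceCharts hcov, hp,
        exists_bundle_moduli isRegular_Z_zero_two hp hcov⟩
  · intro Γ hΓ h
    have hO := (isotropy_ne_bot_iff hΓ).1 h
    have : Fact (Nat.Prime 3) := ⟨Nat.prime_three⟩
    -- Groups of the same prime order are isomorphic, so the cardinality suffices.
    refine ⟨⟨mulEquivOfPrimeCardEq (p := 3) (card_isotropy_of_mem_orbit hO) (by simp)⟩, ?_⟩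
    obtain ⟨g, rfl⟩ := hO
    exact locallyIsomorphic_act g Gamma2
  · obtain ⟨cs, h1, h2⟩ := exists_bundle_regularProjection
    exact ⟨cs, regularProjection, fun _ => rfl, h1, h2⟩
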